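/- Let \(a<b\), let \(\gamma\in C^\infty([a,b];\mathbb R^3)\) be parameterized by arc-length, with unit tangent \(T=\gamma'\), and let \(\varrho\in C^\infty([a,b];\mathbb R_{>0})\) be a bending stiffness. Curvature function. A field \(Z\colon[a,b]\to\mathbb R^3\) along a curve with unit tangent \(T\) is a parallel normal field if it is smooth, \(\langle Z,T\rangle=0\), and \(Z'=\lambda T\) for some smooth function \(\lambda\). Let \(N=(N_1,N_2)\) consist of parallel unit normal fields along \(\gamma\) with \(\det(T,N_1,N_2)=1\), and let \(\kappa=(\kappa_1,\kappa_2)\colon[a,b]\to\mathbb R^2\) be the curvature function defined by \(T'=-N\kappa=-(\kappa_1N_1+\kappa_2N_2)\). Holonomy. Fix unit vectors \(W_a\perp T(a)\), \(W_b\perp T(b)\). The holonomy of a curve with the same unit tangents at \(a\) and \(b\) as \(\gamma\) is the angle \(\mathcal T_W\in\mathbb R/2\pi\mathbb Z\) with \(Z(b)=\cos(\mathcal T_W)\,W_b+\sin(\mathcal T_W)\,T(b)\times W_b\), where \(Z\) is the parallel normal field along that curve with \(Z(a)=W_a\). Elasticity. The bending energy of a regular curve is \(\mathcal B_\varrho=\tfrac12\int_a^b\varrho\,\bigl|\tfrac{dT}{ds}\bigr|^2ds\),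 where \(T\) is its unit tangent, \(ds\) its line element, and \(\tfrac{d}{ds}\) the derivative with respect to its arc-length. The curve \(\gamma\) is called holonomy constrained elastic if \(\tfrac{d}{dt}\big|_{t=0}\mathcal B_\varrho(\gamma_t)=0\) for every smooth variation \((\gamma_t)_{t\in[-\varepsilon,\varepsilon]}\) of \(\gamma=\gamma_0\) with compact support in the interior of \([a,b]\) (that is, \(\gamma_t=\gamma\) on \([a,a+\delta]\cup[b-\delta,b]\) for some \(\delta>0\) and all \(t\)) that constrains arc-length and holonomy to first order, i.e. \(\tfrac{d}{dt}\big|_{t=0}|\gamma_t'(x)|=0\) for all \(x\in[a,b]\) and \(\tfrac{d}{dt}\big|_{t=0}\mathcal T_W(\gamma_t)=0\). Then, for every such choice of \(W_a,W_b\) and \(N\), the curve \(\gamma\) is holonomy constrained elastic if and only if there are a function \(\Lambda\in C^\infty([a,b])\) and a constant \(\mu\in\mathbb R\) such that, on \([a,b]\), \[ \begin{cases} 0=(\varrho\kappa)''+\tfrac12\varrho\langle\kappa,\kappa\rangle\kappa+\mu J\kappa'-\Lambda\kappa,\\ 0=\Lambda'+\tfrac12\varrho'\langle\kappa,\kappa\rangle,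 \end{cases} \qquad J=\begin{pmatrix}0&-1\\1&0\end{pmatrix}. \] -/

import Mathlib

open Set Filter Topology
open scoped ContDiff InnerProductSpace

noncomputable section

namespace ElasticCurve

/-- Euclidean three-space. -/
abbrev E3 : Type := EuclideanSpace ℝ (Fin 3)

/-- The plane in which curvature functions of space curves take their values. -/
abbrev E2 : Type := EuclideanSpace ℝ (Fin 2)

/-- The cross product on Euclidean three-space. -/
def cross (u v : E3) : E3 := WithLp.toLp 2 (crossProduct (WithLp.ofLp u) (WithLp.ofLp v))

/-- The rotation `J = (0 -1; 1 0)` of the plane by 90 degrees. -/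
def rotJ (v : E2) : E2 := !₂[-(v 1), v 0]

/-- `f` is a smooth function on the closed interval `[a, b]`, one-sidedly at the end points.
Only the values of `f` on `[a, b]` matter. -/
def SmoothOn {F : Type*} [NormedAddCommGroup F] [NormedSpace ℝ F] (a b : ℝ) (f : ℝ → F) : Prop :=
  ContDiffOn ℝ ∞ f (Icc a b)

/-- The derivative `f'` of a function on the closed interval `[a, b]`. -/
def D {F : Type*} [NormedAddCommGroup F] [NormedSpace ℝ F] (a b : ℝ) (f : ℝ → F) : ℝ → F :=
  derivWithin f (Icc a b)

/-- The derivative `df/ds = f' / |γ'|` with respect to the arc-length of `γ`. -/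
def arcDeriv {F : Type*} [NormedAddCommGroup F] [NormedSpace ℝ F] (a b : ℝ) (γ : ℝ → E3)
    (f : ℝ → F) (x : ℝ) : F :=
  ‖D a b γ x‖⁻¹ • D a b f x

/-- The unit tangent field `T = dγ/ds`. -/
def unitTangent (a b : ℝ) (γ : ℝ → E3) : ℝ → E3 := arcDeriv a b γ γ

/-- `γ` is parameterized by arc-length. -/
def IsArcLengthParam (a b : ℝ) (γ : ℝ → E3) : Prop := ∀ x ∈ Icc a b, ‖D a b γ x‖ = 1

/-- The bending energy `1/2 ∫ ϱ |dT/ds|² ds`, `ds = |γ'| dx`, with bending stiffness `ϱ`. -/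
def bendingEnergy (a b : ℝ) (ϱ : ℝ → ℝ) (γ : ℝ → E3) : ℝ :=
  (1 / 2) * ∫ x in a..b,
    ϱ x * ⟪arcDeriv a b γ (unitTangent a b γ) x, arcDeriv a b γ (unitTangent a b γ) x⟫_ℝ
      * ‖D a b γ x‖

/-- `Z` is a parallel normal field along `γ`: it is orthogonal to `T` and `Z' = l T`
for a smooth function `l`. -/
structure IsParallelNormalField (a b : ℝ) (γ Z : ℝ → E3) : Prop where
  smooth : SmoothOn a b Z
  normal : ∀ x ∈ Icc a b, ⟪Z x, unitTangent a b γ x⟫_ℝ = 0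
  parallel : ∃ l : ℝ → ℝ, SmoothOn a b l ∧ ∀ x ∈ Icc a b, D a b Z x = l x • unitTangent a b γ x

/-- `(Wa, Wb)` is a pair of unit vectors, orthogonal to `T(a)` and to `T(b)` respectively. -/
structure IsNormalPair (a b : ℝ) (γ : ℝ → E3) (Wa Wb : E3) : Prop where
  norm_left : ‖Wa‖ = 1
  norm_right : ‖Wb‖ = 1
  normal_left : ⟪Wa, unitTangent a b γ a⟫_ℝ = 0
  normal_right : ⟪Wb, unitTangent a b γ b⟫_ℝ = 0

/-- The angle `θ ∈ ℝ/2πℤ` is the holonomy of `γ` with respect to `(Wa, Wb)`: the parallel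
transport of `Wa` along `γ` is `cos θ Wb + sin θ T(b) × Wb`. -/
def IsHolonomy (a b : ℝ) (γ : ℝ → E3) (Wa Wb : E3) (θ : Real.Angle) : Prop :=
  ∃ Z : ℝ → E3, IsParallelNormalField a b γ Z ∧ Z a = Wa ∧
    Z b = θ.cos • Wb + θ.sin • cross (unitTangent a b γ b) Wb

/-- `t ↦ g t` is a smooth variation of `γ` with compact support in the interior of `[a, b]`. -/
def IsVariation (a b : ℝ) (γ : ℝ → E3) (g : ℝ → ℝ → E3) : Prop :=
  ∃ ε > 0, ContDiffOn ℝ ∞ (fun p : ℝ × ℝ => g p.1 p.2) (Icc (-ε) ε ×ˢ Icc a b) ∧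
    (∀ x ∈ Icc a b, g 0 x = γ x) ∧
    ∃ δ > 0, ∀ t ∈ Icc (-ε) ε, ∀ x ∈ Icc a b, (x ≤ a + δ ∨ b - δ ≤ x) → g t x = γ x

/-- The variation of the line element `ds = |γ'| dx` along `t ↦ g t` vanishes at `t = 0`,
pointwise on `[a, b]`. -/
def ConstrainsArcLength (a b : ℝ) (g : ℝ → ℝ → E3) : Prop :=
  ∀ x ∈ Icc a b, HasDerivAt (fun t => ‖D a b (g t) x‖) 0 0

/-- The variation of the holonomy along `t ↦ g t` vanishes at `t = 0`. Derivatives of angle-valued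
functions are taken through a real-valued lift of the angle, near `t = 0`. -/
def ConstrainsHolonomy (a b : ℝ) (g : ℝ → ℝ → E3) (Wa Wb : E3) : Prop :=
  ∃ θ : ℝ → ℝ, (∀ᶠ t in 𝓝 (0 : ℝ), IsHolonomy a b (g t) Wa Wb (θ t : Real.Angle)) ∧
    HasDerivAt θ 0 0

/-- `γ` is a holonomy constrained elastic curve with bending stiffness `ϱ`: a critical point of the
bending energy under all variations with compact support in the interior that constrain the
arc-length and the holonomy (measured with respect to `(Wa, Wb)`). -/
def IsHolonomyConstrainedElastic (a b : ℝ) (ϱ : ℝ → ℝ) (γ : ℝ → E3) (Wa Wb : E3) : Prop :=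
  ∀ g : ℝ → ℝ → E3, IsVariation a b γ g → ConstrainsArcLength a b g →
    ConstrainsHolonomy a b g Wa Wb →
    HasDerivAt (fun t => bendingEnergy a b ϱ (g t)) 0 0

/-- `N₁, N₂` are parallel unit normal fields along `γ` with `det (T, N₁, N₂) = 1`. -/
structure IsParallelFrame (a b : ℝ) (γ N₁ N₂ : ℝ → E3) : Prop where
  parallel₁ : IsParallelNormalField a b γ N₁
  parallel₂ : IsParallelNormalField a b γ N₂
  unit₁ : ∀ x ∈ Icc a b, ‖N₁ x‖ = 1
  unit₂ : ∀ x ∈ Icc a b, ‖N₂ x‖ = 1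
  det_eq_one : ∀ x ∈ Icc a b,
    Matrix.det (Matrix.of ![WithLp.ofLp (unitTangent a b γ x), WithLp.ofLp (N₁ x),
      WithLp.ofLp (N₂ x)]) = 1

/-- `κ` is a curvature function of the arc-length parameterized curve `γ`: `T' = -Nκ` for some
parallel frame `N = (N₁, N₂)`. -/
def IsCurvatureFunction (a b : ℝ) (γ : ℝ → E3) (κ : ℝ → E2) : Prop :=
  ∃ N₁ N₂ : ℝ → E3, IsParallelFrame a b γ N₁ N₂ ∧
    ∀ x ∈ Icc a b, D a b (unitTangent a b γ) x = -(κ x 0 • N₁ x + κ x 1 • N₂ x)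

end ElasticCurve

end

/-! Let `Y` be the field of a variation and `ξ = Y'`. Arc-length is preserved to first order exactly
when `ξ ⟂ T`, and then `T` itself varies by `ξ`. Hence the first variation of the energy is `∫ ϱ⟨T',
ξ'⟩ = -∫ ⟨(ϱT')', ξ⟩`, while that of the holonomy is `∫ ⟨T', T × ξ⟩`
(`exists_hasDerivAt_isHolonomy`). Compact support of `Y` means that `ξ` vanishes near the ends and
`∫ ξ = 0`. Conversely, each normal `ξ` of this kind with `∫ ⟨T', T × ξ⟩ = 0` comes from the affine
variation `γ + tY`. This is admissible as it stands because the constraints are imposed only to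
first order.

Criticality thus says that one linear functional of `ξ` vanishes wherever four others do: the three
coordinates of `∫ ξ`, and `∫ ⟨T', T × ξ⟩`. Lagrange multipliers `c ∈ ℝ³` and `μ`
(`exists_multipliers`) turn this into `⟨(ϱT')', ξ⟩ = ⟨c, ξ⟩ + μ⟨T', T × ξ⟩` for all normal `ξ`, the
condition `HasFirstIntegral`.

In a parallel frame it reads `(ϱκ₁)' = -⟨c, N₁⟩ + μκ₂` and `(ϱκ₂)' = -⟨c, N₂⟩ - μκ₁`. Since `Nᵢ' =
κᵢT`, differentiating once gives the Euler-Lagrange system with `Λ = ½ϱ|κ|² - ⟨c, T⟩`. In the other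
direction, a solution of the system determines all three components of a candidate for `c`, and the
equations say precisely that this vector is constant. -/

noncomputable section

namespace ElasticCurve

/-! ### Smooth one-parameter families on a closed interval -/

section Families

variable {V : Type*} [NormedAddCommGroup V] [NormedSpace ℝ V]

/-- `F t x` is smooth in `(t, x)` on the rectangle `[-ε, ε] × [a, b]`. -/
def SmoothFamily (ε a b : ℝ) (F : ℝ → ℝ → V) : Prop :=
  ContDiffOn ℝ ∞ (fun p : ℝ × ℝ => F p.1 p.2) (Icc (-ε) ε ×ˢ Icc a b)

/-- The derivative of a one-parameter family with respect to the parameter, at parameter `0`. -/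
def paramDeriv (F : ℝ → ℝ → V) (x : ℝ) : V := deriv (fun t => F t x) 0

variable {ε a b : ℝ} {F : ℝ → ℝ → V}

theorem uniqueDiffOn_rectangle (hε : 0 < ε) (hab : a < b) :
    UniqueDiffOn ℝ (Icc (-ε) ε ×ˢ Icc a b) :=
  (uniqueDiffOn_Icc (by linarith)).prod (uniqueDiffOn_Icc hab)

theorem SmoothOn.hasDerivWithinAt {f : ℝ → V} (hf : SmoothOn a b f) {x : ℝ} (hx : x ∈ Icc a b) :
    HasDerivWithinAt f (D a b f x) (Icc a b) x :=
  ((hf x hx).differentiableWithinAt (by simp)).hasDerivWithinAt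

theorem SmoothOn.D (hab : a < b) {f : ℝ → V} (hf : SmoothOn a b f) :
    SmoothOn a b (D a b f) :=
  ContDiffOn.derivWithin (n := ∞) hf (uniqueDiffOn_Icc hab) (by simp)

theorem D_eq (hab : a < b) {f : ℝ → V} {f' : V} {x : ℝ} (hx : x ∈ Icc a b)
    (h : HasDerivWithinAt f f' (Icc a b) x) : D a b f x = f' :=
  h.derivWithin (uniqueDiffOn_Icc hab x hx)

theorem D_congr {f g : ℝ → V} (h : ∀ y ∈ Icc a b, f y = g y) {x : ℝ} (hx : x ∈ Icc a b) :
    D a b f x = D a b g x :=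
  derivWithin_congr h (h x hx)

theorem SmoothOn.congr {f g : ℝ → V} (hf : SmoothOn a b f) (h : ∀ y ∈ Icc a b, g y = f y) :
    SmoothOn a b g :=
  ContDiffOn.congr hf h

theorem SmoothFamily.mono {ε' : ℝ} (hF : SmoothFamily ε a b F) (h : ε' ≤ ε) :
    SmoothFamily ε' a b F :=
  ContDiffOn.mono hF (prod_mono (Icc_subset_Icc (by linarith) h) subset_rfl)

theorem SmoothFamily.apply (hF : SmoothFamily ε a b F) {t : ℝ} (ht : t ∈ Icc (-ε) ε) :
    SmoothOn a b (F t) :=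
  ContDiffOn.comp (g := fun p : ℝ × ℝ => F p.1 p.2) (f := fun x => (t, x)) hF
    (contDiff_const.prodMk contDiff_id).contDiffOn fun _ hx => ⟨ht, hx⟩

theorem SmoothOn.family {f : ℝ → V} (hf : SmoothOn a b f) (ε : ℝ) :
    SmoothFamily ε a b (fun _ => f) :=
  ContDiffOn.comp (f := fun p : ℝ × ℝ => p.2) hf contDiff_snd.contDiffOn fun _ hp => hp.2

theorem SmoothFamily.hasDerivWithinAt_snd (hF : SmoothFamily ε a b F)
    {t x : ℝ} (ht : t ∈ Icc (-ε) ε) (hx : x ∈ Icc a b) :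
    HasDerivWithinAt (F t) (fderivWithin ℝ (fun p : ℝ × ℝ => F p.1 p.2)
      (Icc (-ε) ε ×ˢ Icc a b) (t, x) (0, 1)) (Icc a b) x := by
  have h1 := ((hF (t, x) ⟨ht, hx⟩).differentiableWithinAt (by simp)).hasFDerivWithinAt
  have h2 : HasDerivWithinAt (fun y : ℝ => (t, y)) ((0 : ℝ), (1 : ℝ)) (Icc a b) x :=
    ((hasDerivAt_const x t).prodMk (hasDerivAt_id x)).hasDerivWithinAt
  exact h1.comp_hasDerivWithinAt x h2 fun y hy => ⟨ht, hy⟩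

theorem SmoothFamily.hasDerivWithinAt_fst (hF : SmoothFamily ε a b F)
    {t x : ℝ} (ht : t ∈ Icc (-ε) ε) (hx : x ∈ Icc a b) :
    HasDerivWithinAt (fun s => F s x) (fderivWithin ℝ (fun p : ℝ × ℝ => F p.1 p.2)
      (Icc (-ε) ε ×ˢ Icc a b) (t, x) (1, 0)) (Icc (-ε) ε) t := by
  have h1 := ((hF (t, x) ⟨ht, hx⟩).differentiableWithinAt (by simp)).hasFDerivWithinAt
  have h2 : HasDerivWithinAt (fun s : ℝ => (s, x)) ((1 : ℝ), (0 : ℝ)) (Icc (-ε) ε) t :=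
    ((hasDerivAt_id t).prodMk (hasDerivAt_const t x)).hasDerivWithinAt
  exact h1.comp_hasDerivWithinAt t h2 fun _ hy => mk_mem_prod hy hx

theorem SmoothFamily.hasDerivAt_fst (hF : SmoothFamily ε a b F)
    {t x : ℝ} (ht : t ∈ Ioo (-ε) ε) (hx : x ∈ Icc a b) :
    HasDerivAt (fun s => F s x) (fderivWithin ℝ (fun p : ℝ × ℝ => F p.1 p.2)
      (Icc (-ε) ε ×ˢ Icc a b) (t, x) (1, 0)) t :=
  (hF.hasDerivWithinAt_fst (Ioo_subset_Icc_self ht) hx).hasDerivAt (Icc_mem_nhds ht.1 ht.2)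

theorem SmoothFamily.contDiffOn_fderivWithin (hF : SmoothFamily ε a b F) (hε : 0 < ε)
    (hab : a < b) : ContDiffOn ℝ ∞ (fderivWithin ℝ (fun p : ℝ × ℝ => F p.1 p.2)
      (Icc (-ε) ε ×ˢ Icc a b)) (Icc (-ε) ε ×ˢ Icc a b) :=
  ContDiffOn.fderivWithin (n := ∞) hF (uniqueDiffOn_rectangle hε hab) (by simp)

theorem SmoothFamily.D (hF : SmoothFamily ε a b F) (hε : 0 < ε) (hab : a < b) :
    SmoothFamily ε a b (fun t => D a b (F t)) :=
  ((hF.contDiffOn_fderivWithin hε hab).clm_apply (contDiffOn_const (c := ((0 : ℝ), (1 : ℝ))))).congr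
    fun _ hp => D_eq hab hp.2 (hF.hasDerivWithinAt_snd hp.1 hp.2)

theorem SmoothFamily.smoothOn_paramDeriv (hF : SmoothFamily ε a b F) (hε : 0 < ε)
    (hab : a < b) : SmoothOn a b (paramDeriv F) := by
  have h := (hF.contDiffOn_fderivWithin hε hab).clm_apply
    (contDiffOn_const (c := ((1 : ℝ), (0 : ℝ))))
  exact (SmoothFamily.apply (F := fun t x => fderivWithin ℝ (fun p : ℝ × ℝ => F p.1 p.2)
      (Icc (-ε) ε ×ˢ Icc a b) (t, x) (1, 0)) h (t := 0) ⟨by linarith, hε.le⟩).congr fun x hx =>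
    (hF.hasDerivAt_fst (t := 0) ⟨by linarith, hε⟩ hx).deriv

/-- The derivatives with respect to the parameter and to the position commute. -/
theorem SmoothFamily.hasDerivAt_D (hF : SmoothFamily ε a b F) (hε : 0 < ε) (hab : a < b)
    {x : ℝ} (hx : x ∈ Icc a b) :
    HasDerivAt (fun t => ElasticCurve.D a b (F t) x) (ElasticCurve.D a b (paramDeriv F) x) 0 := by
  set K := Icc (-ε) ε ×ˢ Icc a b
  set f : ℝ × ℝ → V := fun p => F p.1 p.2
  have h0 : (0 : ℝ) ∈ Ioo (-ε) ε := ⟨by linarith, hε⟩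
  have hp : ((0 : ℝ), x) ∈ K := ⟨Ioo_subset_Icc_self h0, hx⟩
  have hU := uniqueDiffOn_rectangle hε hab
  have hf' := hF.contDiffOn_fderivWithin hε hab
  -- Symmetry is needed also at `x = a` and `x = b`; it holds there because the rectangle is the
  -- closure of its interior.
  have hsymm : IsSymmSndFDerivWithinAt ℝ f K (0, x) := by
    refine (hF (0, x) hp).isSymmSndFDerivWithinAt
      (by simpa using WithTop.coe_le_coe.2 (le_top (a := (2 : ℕ∞)))) hU ?_ hp
    rw [interior_prod_eq, closure_prod_eq, interior_Icc, interior_Icc,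
      closure_Ioo (by linarith), closure_Ioo hab.ne]
    exact hp
  have hd : DifferentiableWithinAt ℝ (fderivWithin ℝ f K) K (0, x) :=
    (hf' _ hp).differentiableWithinAt (by simp)
  have key : ∀ v w : ℝ × ℝ, fderivWithin ℝ (fun p => fderivWithin ℝ f K p v) K (0, x) w
      = fderivWithin ℝ (fderivWithin ℝ f K) K (0, x) w v := by
    intro v w
    rw [fderivWithin_clm_apply (hU _ hp) hd (differentiableWithinAt_const v)]
    simp [-Icc_prod_Icc, K]
  have h1 := (hF.D hε hab).hasDerivAt_fst h0 hx
  have e1 : fderivWithin ℝ (fun p : ℝ × ℝ => ElasticCurve.D a b (F p.1) p.2) K (0, x)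
      = fderivWithin ℝ (fun p => fderivWithin ℝ f K p (0, 1)) K (0, x) :=
    fderivWithin_congr (fun p hp => D_eq hab hp.2 (hF.hasDerivWithinAt_snd hp.1 hp.2))
      (D_eq hab hx (hF.hasDerivWithinAt_snd hp.1 hx))
  have hG : SmoothFamily ε a b (fun t x => fderivWithin ℝ f K (t, x) (1, 0)) :=
    hf'.clm_apply (contDiffOn_const (c := ((1 : ℝ), (0 : ℝ))))
  have h2 := hG.hasDerivWithinAt_snd hp.1 hx
  have e2 : ElasticCurve.D a b (paramDeriv F) x
      = fderivWithin ℝ (fun p => fderivWithin ℝ f K p (1, 0)) K (0, x) (0, 1) := by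
    rw [← D_eq hab hx h2]
    exact D_congr (fun y hy => (hF.hasDerivAt_fst h0 hy).deriv) hx
  rw [e1, key, hsymm.eq, ← key, ← e2] at h1
  exact h1

/-- Differentiation under the integral sign. -/
theorem SmoothFamily.hasDerivAt_integral [CompleteSpace V] (hF : SmoothFamily ε a b F)
    (hε : 0 < ε) (hab : a < b) :
    HasDerivAt (fun t => ∫ x in a..b, F t x) (∫ x in a..b, paramDeriv F x) 0 := by
  have h0 : (0 : ℝ) ∈ Ioo (-ε) ε := ⟨by linarith, hε⟩
  set K := Icc (-ε) ε ×ˢ Icc a b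
  set F' : ℝ → ℝ → V := fun t x => fderivWithin ℝ (fun p : ℝ × ℝ => F p.1 p.2) K (t, x) (1, 0)
  have hF' : SmoothFamily ε a b F' := (hF.contDiffOn_fderivWithin hε hab).clm_apply
    (contDiffOn_const (c := ((1 : ℝ), (0 : ℝ))))
  obtain ⟨C, hC⟩ := (isCompact_Icc.prod isCompact_Icc).exists_bound_of_continuousOn
    hF'.continuousOn
  have hsub : Set.uIoc a b ⊆ Icc a b := by
    rw [uIoc_of_le hab.le]; exact Ioc_subset_Icc_self
  have hint : ∀ {G : ℝ → ℝ → V}, SmoothFamily ε a b G → ∀ t ∈ Ioo (-ε) ε,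
      IntervalIntegrable (G t) MeasureTheory.volume a b := fun hG t ht =>
    ContinuousOn.intervalIntegrable (by
      rw [uIcc_of_le hab.le]; exact (hG.apply (Ioo_subset_Icc_self ht)).continuousOn)
  have hmeas : ∀ {G : ℝ → ℝ → V}, SmoothFamily ε a b G → ∀ t ∈ Ioo (-ε) ε,
      MeasureTheory.AEStronglyMeasurable (G t)
        (MeasureTheory.volume.restrict (Set.uIoc a b)) := fun hG t ht =>
    (intervalIntegrable_iff.1 (hint hG t ht)).aestronglyMeasurable
  have := (intervalIntegral.hasDerivAt_integral_of_dominated_loc_of_deriv_le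
    (μ := MeasureTheory.volume) (a := a) (b := b)
    (F := F) (F' := F') (x₀ := 0) (s := Ioo (-ε) ε) (bound := fun _ => C)
    (Ioo_mem_nhds h0.1 h0.2)
    (by filter_upwards [Ioo_mem_nhds h0.1 h0.2] with t ht using hmeas hF t ht)
    (hint hF 0 h0) (hmeas hF' 0 h0)
    (.of_forall fun x hx t ht => hC (t, x) ⟨Ioo_subset_Icc_self ht, hsub hx⟩)
    intervalIntegrable_const
    (.of_forall fun x hx t ht => hF.hasDerivAt_fst ht (hsub hx))).2
  convert this using 1
  refine intervalIntegral.integral_congr fun x hx => ?_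
  rw [uIcc_of_le hab.le] at hx
  exact (hF.hasDerivAt_fst h0 hx).deriv

/-- Open conditions that hold at parameter `0` hold near parameter `0`. -/
theorem SmoothFamily.exists_forall_mem (hF : SmoothFamily ε a b F) (hε : 0 < ε)
    {U : Set V} (hU : IsOpen U) (h : ∀ x ∈ Icc a b, F 0 x ∈ U) :
    ∃ ε' > 0, ε' ≤ ε ∧ ∀ t ∈ Icc (-ε') ε', ∀ x ∈ Icc a b, F t x ∈ U := by
  have h0 : (0 : ℝ) ∈ Icc (-ε) ε := ⟨by linarith, hε.le⟩
  -- Compactness of `[a, b]` makes the neighbourhood of `0` uniform in `x`. Membership in the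
  -- rectangle is a premise of the predicate because continuity is known only within the rectangle.
  have : ∀ᶠ t in 𝓝 (0 : ℝ), ∀ x ∈ Icc a b, (t ∈ Icc (-ε) ε → x ∈ Icc a b → F t x ∈ U) := by
    refine isCompact_Icc.eventually_forall_of_forall_eventually
      (P := fun t x => t ∈ Icc (-ε) ε → x ∈ Icc a b → F t x ∈ U) fun y hy => ?_
    have := hF.continuousOn (0, y) ⟨h0, hy⟩ (hU.mem_nhds (h y hy))
    rw [mem_map, mem_nhdsWithin_iff_eventually] at this
    filter_upwards [this] with p hp h1 h2 using hp ⟨h1, h2⟩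
  obtain ⟨r, hr, hr'⟩ := Metric.eventually_nhds_iff.1 this
  refine ⟨min ε (r / 2), by positivity, min_le_left _ _, fun t ht x hx => ?_⟩
  have h1 := min_le_left ε (r / 2)
  have h2 := min_le_right ε (r / 2)
  refine hr' ?_ x hx ⟨by linarith [ht.1], by linarith [ht.2]⟩ hx
  rw [Real.dist_eq, sub_zero, abs_lt]
  constructor <;> linarith [ht.1, ht.2]

end Families

/-! ### Cross product and orthonormal frames of three-space -/

section CrossProduct

theorem inner_eq_coord (u v : E3) : ⟪u, v⟫_ℝ = u 0 * v 0 + u 1 * v 1 + u 2 * v 2 := by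
  rw [PiLp.inner_apply, Fin.sum_univ_three]
  simp [mul_comm]

theorem inner_eq_coord_plane (u v : E2) : ⟪u, v⟫_ℝ = u 0 * v 0 + u 1 * v 1 := by
  rw [PiLp.inner_apply, Fin.sum_univ_two]
  simp [mul_comm]

theorem cross_zero_coord (u v : E3) : cross u v 0 = u 1 * v 2 - u 2 * v 1 := by
  simp [cross, cross_apply]

theorem cross_one_coord (u v : E3) : cross u v 1 = u 2 * v 0 - u 0 * v 2 := by
  simp [cross, cross_apply]

theorem cross_two_coord (u v : E3) : cross u v 2 = u 0 * v 1 - u 1 * v 0 := by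
  simp [cross, cross_apply]

theorem inner_cross_self_left (u v : E3) : ⟪cross u v, u⟫_ℝ = 0 := by
  rw [inner_eq_coord, cross_zero_coord, cross_one_coord, cross_two_coord]; ring

theorem inner_cross_self_right (u v : E3) : ⟪cross u v, v⟫_ℝ = 0 := by
  rw [inner_eq_coord, cross_zero_coord, cross_one_coord, cross_two_coord]; ring

theorem inner_cross_swap (u v w : E3) : ⟪u, cross v w⟫_ℝ = -⟪v, cross u w⟫_ℝ := by
  simp only [inner_eq_coord, cross_zero_coord, cross_one_coord, cross_two_coord]; ring

theorem inner_cross_cross (u v w z : E3) :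
    ⟪cross u v, cross w z⟫_ℝ = ⟪u, w⟫_ℝ * ⟪v, z⟫_ℝ - ⟪u, z⟫_ℝ * ⟪v, w⟫_ℝ := by
  simp only [inner_eq_coord, cross_zero_coord, cross_one_coord, cross_two_coord]; ring

theorem cross_cross (u v w : E3) :
    cross u (cross v w) = ⟪u, w⟫_ℝ • v - ⟪u, v⟫_ℝ • w := by
  ext i
  fin_cases i <;>
  simp [inner_eq_coord, cross_zero_coord, cross_one_coord, cross_two_coord] <;> ring

theorem det_eq_inner_cross (u v w : E3) :
    Matrix.det (Matrix.of ![WithLp.ofLp u, WithLp.ofLp v, WithLp.ofLp w]) = ⟪cross u v, w⟫_ℝ := by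
  simp only [inner_eq_coord, cross_zero_coord, cross_one_coord, cross_two_coord,
    Matrix.det_fin_three]
  simp
  ring

theorem cross_add_right (u v w : E3) : cross u (v + w) = cross u v + cross u w := by
  simp [cross]

theorem cross_smul_right (r : ℝ) (u v : E3) : cross u (r • v) = r • cross u v := by
  simp [cross]

theorem cross_self (u : E3) : cross u u = 0 := by
  simp [cross]

/-- The cross product as a continuous bilinear map. -/
def crossBilin : E3 →L[ℝ] E3 →L[ℝ] E3 :=
  (LinearMap.mk₂ ℝ cross (by simp [cross]) (by simp [cross]) cross_add_right
    cross_smul_right).toContinuousBilinearMap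

theorem _root_.ContDiffOn.cross {E : Type*} [NormedAddCommGroup E] [NormedSpace ℝ E] {n : ℕ∞ω}
    {s : Set E} {f g : E → E3} (hf : ContDiffOn ℝ n f s) (hg : ContDiffOn ℝ n g s) :
    ContDiffOn ℝ n (fun x => cross (f x) (g x)) s :=
  crossBilin.isBoundedBilinearMap.contDiff.comp_contDiffOn (hf.prodMk hg)

theorem _root_.HasDerivAt.cross {f g : ℝ → E3} {f' g' : E3} {x : ℝ} (hf : HasDerivAt f f' x)
    (hg : HasDerivAt g g' x) :
    HasDerivAt (fun x => cross (f x) (g x)) (cross (f x) g' + cross f' (g x)) x :=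
  crossBilin.hasDerivAt_of_bilinear (fun _ => hf) fun _ => hg

variable {T M : E3}

theorem norm_cross_of_orthonormal (hT : ‖T‖ = 1) (hM : ‖M‖ = 1) (h : ⟪M, T⟫_ℝ = 0) :
    ‖cross T M‖ = 1 := by
  have : ‖cross T M‖ ^ 2 = 1 := by
    rw [← real_inner_self_eq_norm_sq, inner_cross_cross, real_inner_self_eq_norm_sq,
      real_inner_self_eq_norm_sq, h, hT, hM]
    norm_num
  nlinarith [norm_nonneg (cross T M)]

theorem cross_cross_of_orthonormal (hT : ‖T‖ = 1) (h : ⟪M, T⟫_ℝ = 0) :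
    cross T (cross T M) = -M := by
  rw [cross_cross, real_inner_comm, h, real_inner_self_eq_norm_sq, hT]
  simp

/-- Expansion with respect to the orthonormal basis `T, M, T × M`. -/
theorem eq_sum_inner_smul (hT : ‖T‖ = 1) (hM : ‖M‖ = 1) (h : ⟪M, T⟫_ℝ = 0) (v : E3) :
    v = ⟪v, T⟫_ℝ • T + ⟪v, M⟫_ℝ • M + ⟪v, cross T M⟫_ℝ • cross T M := by
  have hB := norm_cross_of_orthonormal hT hM h
  have hon : Orthonormal ℝ ![T, M, cross T M] := by
    rw [orthonormal_iff_ite]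
    intro i j
    have h1 := inner_cross_self_left T M
    have h2 := inner_cross_self_right T M
    fin_cases i <;> fin_cases j <;>
      simp [hT, hM, hB, h, h1, h2]
    all_goals first | (rw [real_inner_comm]; assumption)
  have hc : Fintype.card (Fin 3) = Module.finrank ℝ E3 := by simp
  let b := (basisOfOrthonormalOfCardEqFinrank hon hc).toOrthonormalBasis (by simpa using hon)
  have hb : ⇑b = ![T, M, cross T M] := by simp [b]
  have := b.sum_repr' v
  rw [Fin.sum_univ_three, hb] at this
  simpa [real_inner_comm] using this.symm

/-- The determinant is the inner product of the unit vectors `T × M` and `N`, so the value `1` is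
the equality case of Cauchy-Schwarz. -/
theorem eq_cross_of_det_eq_one {N : E3} (hT : ‖T‖ = 1) (hM : ‖M‖ = 1) (h : ⟪M, T⟫_ℝ = 0)
    (hN : ‖N‖ = 1)
    (hd : Matrix.det (Matrix.of ![WithLp.ofLp T, WithLp.ofLp M, WithLp.ofLp N]) = 1) :
    N = cross T M := by
  rw [det_eq_inner_cross] at hd
  exact ((inner_eq_one_iff_of_norm_eq_one (norm_cross_of_orthonormal hT hM h) hN).1 hd).symm

/-- A unit vector orthogonal to `T` in terms of the basis `M, T × M` of the normal plane. -/
theorem exists_angle (hT : ‖T‖ = 1) (hM : ‖M‖ = 1) (h : ⟪M, T⟫_ℝ = 0) {v : E3} (hv : ‖v‖ = 1)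
    (hvT : ⟪v, T⟫_ℝ = 0) :
    ∃ α : ℝ, v = Real.cos α • M + Real.sin α • cross T M := by
  have e := eq_sum_inner_smul hT hM h v
  rw [hvT, zero_smul, zero_add] at e
  have hB := norm_cross_of_orthonormal hT hM h
  have hs : ⟪v, M⟫_ℝ ^ 2 + ⟪v, cross T M⟫_ℝ ^ 2 = 1 := by
    have h1 : ⟪v, v⟫_ℝ = 1 := by rw [real_inner_self_eq_norm_sq, hv]; norm_num
    nth_rewrite 2 [e] at h1
    rw [inner_add_right, inner_smul_right, inner_smul_right] at h1
    linarith
  -- The coordinates of `v` form a unit complex number, whose argument is the required angle.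
  set z : ℂ := ⟨⟪v, M⟫_ℝ, ⟪v, cross T M⟫_ℝ⟩ with hz
  have hz1 : ‖z‖ = 1 := by
    rw [Complex.norm_eq_sqrt_sq_add_sq, hs, Real.sqrt_one]
  have hz0 : z ≠ 0 := by rw [← norm_ne_zero_iff, hz1]; norm_num
  refine ⟨Complex.arg z, ?_⟩
  rw [Complex.cos_arg hz0, Complex.sin_arg, hz1]
  simpa [hz] using e

end CrossProduct

/-! ### Calculus on a closed interval -/

section Interval

variable {V : Type*} [NormedAddCommGroup V] [NormedSpace ℝ V] {a b : ℝ}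

theorem SmoothOn.eq_of_D_eq_zero {f : ℝ → V} (hf : SmoothOn a b f)
    (h : ∀ x ∈ Icc a b, ElasticCurve.D a b f x = 0) {x : ℝ} (hx : x ∈ Icc a b) : f x = f a :=
  constant_of_derivWithin_zero (hf.differentiableOn (by simp))
    (fun y hy => h y (Ico_subset_Icc_self hy)) x hx

theorem D_inner {E : Type*} [NormedAddCommGroup E] [InnerProductSpace ℝ E] (hab : a < b)
    {f g : ℝ → E} (hf : SmoothOn a b f) (hg : SmoothOn a b g) {x : ℝ} (hx : x ∈ Icc a b) :
    D a b (fun y => ⟪f y, g y⟫_ℝ) x = ⟪f x, D a b g x⟫_ℝ + ⟪D a b f x, g x⟫_ℝ :=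
  D_eq hab hx ((hf.hasDerivWithinAt hx).inner ℝ (hg.hasDerivWithinAt hx))

theorem inner_D_eq_neg {E : Type*} [NormedAddCommGroup E] [InnerProductSpace ℝ E] (hab : a < b)
    {f g : ℝ → E} (hf : SmoothOn a b f) (hg : SmoothOn a b g) {c : ℝ}
    (h : ∀ y ∈ Icc a b, ⟪f y, g y⟫_ℝ = c) {x : ℝ} (hx : x ∈ Icc a b) :
    ⟪D a b f x, g x⟫_ℝ = -⟪f x, D a b g x⟫_ℝ := by
  have h1 := D_inner hab hf hg hx
  rw [D_congr (g := fun _ => c) h hx, D_eq hab hx (hasDerivWithinAt_const x _ c)] at h1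
  linarith

theorem SmoothOn.hasDerivWithinAt_integral [CompleteSpace V] {f : ℝ → V} (hf : SmoothOn a b f)
    {x : ℝ} (hx : x ∈ Icc a b) :
    HasDerivWithinAt (fun y => ∫ s in a..y, f s) (f x) (Icc a b) x := by
  have hc := hf.continuousOn
  have := Fact.mk hx
  refine intervalIntegral.integral_hasDerivWithinAt_right ?_
    (hc.stronglyMeasurableAtFilter_nhdsWithin measurableSet_Icc x) (hc x hx)
  refine (hc.mono ?_).intervalIntegrable
  rw [uIcc_of_le hx.1]
  exact Icc_subset_Icc_right hx.2

theorem SmoothOn.integral [CompleteSpace V] (hab : a < b) {f : ℝ → V} (hf : SmoothOn a b f) :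
    SmoothOn a b (fun y => ∫ s in a..y, f s) :=
  (contDiffOn_infty_iff_derivWithin (uniqueDiffOn_Icc hab)).2
    ⟨fun _ hx => (hf.hasDerivWithinAt_integral hx).differentiableWithinAt,
      hf.congr fun _ hx => D_eq hab hx (hf.hasDerivWithinAt_integral hx)⟩

theorem SmoothOn.intervalIntegrable (hab : a < b) {f : ℝ → V} (hf : SmoothOn a b f) :
    IntervalIntegrable f MeasureTheory.volume a b :=
  ContinuousOn.intervalIntegrable (by rw [uIcc_of_le hab.le]; exact hf.continuousOn)

/-- The fundamental theorem of calculus for smooth functions on `[a, b]`. -/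
theorem SmoothOn.integral_D [CompleteSpace V] (hab : a < b) {f : ℝ → V} (hf : SmoothOn a b f) :
    ∫ x in a..b, ElasticCurve.D a b f x = f b - f a :=
  intervalIntegral.integral_eq_sub_of_hasDerivAt_of_le hab.le hf.continuousOn
    (fun _ hx => (hf.hasDerivWithinAt (Ioo_subset_Icc_self hx)).hasDerivAt
      (Icc_mem_nhds hx.1 hx.2)) ((hf.D hab).intervalIntegrable hab)

end Interval

/-! ### Parallel transport: existence and uniqueness -/

section ParallelTransport

variable {a b : ℝ} {c : ℝ → E3}

/-- The parallel transport of `cos α M + sin α T × M`, in terms of a unit normal field `M`. -/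
theorem exists_isParallelNormalField (hab : a < b) {M : ℝ → E3}
    (hT : SmoothOn a b (unitTangent a b c)) (hT1 : ∀ x ∈ Icc a b, ‖unitTangent a b c x‖ = 1)
    (hM : SmoothOn a b M) (hM1 : ∀ x ∈ Icc a b, ‖M x‖ = 1)
    (hMT : ∀ x ∈ Icc a b, ⟪M x, unitTangent a b c x⟫_ℝ = 0) (α : ℝ) :
    ∃ Z, IsParallelNormalField a b c Z ∧
      Z a = Real.cos α • M a + Real.sin α • cross (unitTangent a b c a) (M a) ∧
      Z b = Real.cos (α - ∫ x in a..b, ⟪D a b M x, cross (unitTangent a b c x) (M x)⟫_ℝ) • M b +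
        Real.sin (α - ∫ x in a..b, ⟪D a b M x, cross (unitTangent a b c x) (M x)⟫_ℝ) •
          cross (unitTangent a b c b) (M b) := by
  set T := unitTangent a b c
  set B : ℝ → E3 := fun x => cross (T x) (M x)
  have hB : SmoothOn a b B := ContDiffOn.cross hT hM
  have hq : SmoothOn a b (fun x => ⟪D a b M x, B x⟫_ℝ) := ContDiffOn.inner ℝ (hM.D hab) hB
  set q : ℝ → ℝ := fun x => ⟪D a b M x, B x⟫_ℝ
  -- For `Z = cos φ M + sin φ B`, the components of `Z'` along `M` and `B` are `-sin φ (φ' + q)` and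
  -- `cos φ (φ' + q)`. So `Z` is parallel once `φ' = -q`.
  set φ : ℝ → ℝ := fun x => α - ∫ s in a..x, q s
  have hφ : SmoothOn a b φ := contDiffOn_const.sub (hq.integral hab)
  have hφ' : ∀ x ∈ Icc a b, HasDerivWithinAt φ (-q x) (Icc a b) x := fun x hx =>
    (hq.hasDerivWithinAt_integral hx).const_sub α
  set Z : ℝ → E3 := fun x => Real.cos (φ x) • M x + Real.sin (φ x) • B x
  have hZ : SmoothOn a b Z :=
    ((Real.contDiff_cos.comp_contDiffOn hφ).smul hM).add
      ((Real.contDiff_sin.comp_contDiffOn hφ).smul hB)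
  have hZT : ∀ x ∈ Icc a b, ⟪Z x, T x⟫_ℝ = 0 := fun x hx => by
    simp only [Z, B, inner_add_left, inner_smul_left, hMT x hx, inner_cross_self_left]
    simp
  refine ⟨Z, ⟨hZ, hZT, fun x => ⟪D a b Z x, T x⟫_ℝ, ContDiffOn.inner ℝ (hZ.D hab) hT, ?_⟩, ?_, rfl⟩
  · intro x hx
    have hd : D a b Z x = _ := D_eq hab hx
      (((hφ' x hx).cos.smul (hM.hasDerivWithinAt hx)).add
        ((hφ' x hx).sin.smul (hB.hasDerivWithinAt hx)))
    have hB1 : ∀ y ∈ Icc a b, ⟪B y, B y⟫_ℝ = 1 := fun y hy => by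
      rw [real_inner_self_eq_norm_sq, norm_cross_of_orthonormal (hT1 y hy) (hM1 y hy) (hMT y hy)]
      norm_num
    have hMM : ∀ y ∈ Icc a b, ⟪M y, M y⟫_ℝ = 1 := fun y hy => by
      rw [real_inner_self_eq_norm_sq, hM1 y hy]; norm_num
    have hBM : ∀ y ∈ Icc a b, ⟪B y, M y⟫_ℝ = 0 := fun y _ => inner_cross_self_right _ _
    have e1 := inner_D_eq_neg hab hM hM hMM hx
    have e2 := inner_D_eq_neg hab hB hB hB1 hx
    have e3 := inner_D_eq_neg hab hB hM hBM hx
    rw [real_inner_comm (D a b M x)] at e1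
    rw [real_inner_comm (D a b B x)] at e2
    have e4 : ⟪M x, B x⟫_ℝ = 0 := by rw [real_inner_comm]; exact hBM x hx
    have e5 : ⟪B x, D a b M x⟫_ℝ = q x := real_inner_comm _ _
    have e6 : ⟪D a b M x, B x⟫_ℝ = q x := rfl
    have h1 : ⟪D a b Z x, M x⟫_ℝ = 0 := by
      rw [hd]
      simp only [inner_add_left, inner_smul_left, hMM x hx, hBM x hx, e3, e5, conj_trivial]
      linear_combination Real.cos (φ x) * (1 / 2) * e1
    have h2 : ⟪D a b Z x, B x⟫_ℝ = 0 := by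
      rw [hd]
      simp only [inner_add_left, inner_smul_left, hB1 x hx, e4, e6, conj_trivial]
      linear_combination Real.sin (φ x) * (1 / 2) * e2
    have := eq_sum_inner_smul (hT1 x hx) (hM1 x hx) (hMT x hx) (D a b Z x)
    change D a b Z x = _ + _ + ⟪D a b Z x, B x⟫_ℝ • _ at this
    rw [h1, h2] at this
    simpa using this
  · simp [Z, φ, B]

/-- Parallel transport is determined by its initial value. -/
theorem IsParallelNormalField.eq_of_eq_left (hab : a < b) {Z₁ Z₂ : ℝ → E3}
    (h₁ : IsParallelNormalField a b c Z₁) (h₂ : IsParallelNormalField a b c Z₂)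
    (h : Z₁ a = Z₂ a) : Z₁ b = Z₂ b := by
  have hs : SmoothOn a b (fun x => Z₁ x - Z₂ x) := ContDiffOn.sub h₁.smooth h₂.smooth
  -- The difference is normal and its derivative is tangential, so its length is constant.
  have hD : ∀ x ∈ Icc a b, D a b (fun y => ⟪Z₁ y - Z₂ y, Z₁ y - Z₂ y⟫_ℝ) x = 0 := by
    intro x hx
    obtain ⟨l₁, -, hl₁⟩ := h₁.parallel
    obtain ⟨l₂, -, hl₂⟩ := h₂.parallel
    have : D a b (fun x => Z₁ x - Z₂ x) x = (l₁ x - l₂ x) • unitTangent a b c x := by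
      rw [sub_smul, ← hl₁ x hx, ← hl₂ x hx]
      exact D_eq hab hx ((h₁.smooth.hasDerivWithinAt hx).sub (h₂.smooth.hasDerivWithinAt hx))
    rw [D_inner hab hs hs hx, this, inner_smul_right, inner_smul_left,
      real_inner_comm _ (unitTangent a b c x), inner_sub_left, h₁.normal x hx, h₂.normal x hx]
    simp
  have := SmoothOn.eq_of_D_eq_zero (ContDiffOn.inner ℝ hs hs) hD ⟨hab.le, le_rfl⟩
  rw [h, sub_self, inner_zero_left, inner_self_eq_zero] at this
  exact sub_eq_zero.1 this

end ParallelTransport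

/-! ### Normalizing a vector-valued path -/

section Normalize

variable {E : Type*} [NormedAddCommGroup E] [InnerProductSpace ℝ E]

theorem hasDerivAt_norm_of_norm_eq_one {v : ℝ → E} {v' : E} {t : ℝ} (hv : HasDerivAt v v' t)
    (h1 : ‖v t‖ = 1) : HasDerivAt (fun s => ‖v s‖) ⟪v t, v'⟫_ℝ t := by
  have h := hv.norm_sq.sqrt (by rw [h1]; norm_num)
  simp only [Real.sqrt_sq (norm_nonneg _), h1] at h
  convert! h using 1
  ring

/-- A velocity orthogonal to a unit vector does not change its length to first order, so
normalization leaves the velocity unchanged. This serves both for unit tangents and for the normal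
field in the holonomy computation. -/
theorem hasDerivAt_normalize {v : ℝ → E} {v' : E} {t : ℝ} (hv : HasDerivAt v v' t)
    (h1 : ‖v t‖ = 1) (h0 : ⟪v t, v'⟫_ℝ = 0) :
    HasDerivAt (fun s => ‖v s‖⁻¹ • v s) v' t := by
  have h2 := hasDerivAt_norm_of_norm_eq_one hv h1
  rw [h0] at h2
  have h := (h2.inv (by rw [h1]; norm_num)).smul hv
  convert! h using 1
  simp [h1]

theorem norm_normalize {v : E} (hv : v ≠ 0) : ‖‖v‖⁻¹ • v‖ = 1 := by
  rw [norm_smul, norm_inv, norm_norm, inv_mul_cancel₀ (norm_ne_zero_iff.2 hv)]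

theorem SmoothFamily.normalize {ε a b : ℝ} {F : ℝ → ℝ → E} (hF : SmoothFamily ε a b F)
    (h : ∀ t ∈ Icc (-ε) ε, ∀ x ∈ Icc a b, F t x ≠ 0) :
    SmoothFamily ε a b (fun t x => ‖F t x‖⁻¹ • F t x) :=
  ((ContDiffOn.norm ℝ hF fun p hp => h p.1 hp.1 p.2 hp.2).inv
    fun p hp => norm_ne_zero_iff.2 (h p.1 hp.1 p.2 hp.2)).smul hF

end Normalize

/-! ### Unit tangent fields -/

variable {a b : ℝ} {γ : ℝ → E3}

theorem IsArcLengthParam.unitTangent_eq (hγ1 : IsArcLengthParam a b γ) {x : ℝ}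
    (hx : x ∈ Icc a b) : unitTangent a b γ x = D a b γ x := by
  simp [unitTangent, arcDeriv, hγ1 x hx]

theorem IsArcLengthParam.norm_unitTangent (hγ1 : IsArcLengthParam a b γ) {x : ℝ}
    (hx : x ∈ Icc a b) : ‖unitTangent a b γ x‖ = 1 := by
  rw [hγ1.unitTangent_eq hx, hγ1 x hx]

theorem IsArcLengthParam.smoothOn_unitTangent (hγ1 : IsArcLengthParam a b γ) (hab : a < b)
    (hγ : SmoothOn a b γ) : SmoothOn a b (unitTangent a b γ) :=
  (hγ.D hab).congr fun _ hx => hγ1.unitTangent_eq hx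

theorem norm_unitTangent {c : ℝ → E3} {x : ℝ} (h : D a b c x ≠ 0) : ‖unitTangent a b c x‖ = 1 :=
  norm_normalize h

theorem unitTangent_congr {c : ℝ → E3} {x : ℝ} (hx : x ∈ Icc a b)
    (h : ∀ᶠ y in 𝓝[Icc a b] x, c y = γ y) : unitTangent a b c x = unitTangent a b γ x := by
  have : D a b c x = D a b γ x := Filter.EventuallyEq.derivWithin_eq_of_mem h hx
  simp only [unitTangent, arcDeriv, this]

/-! ### First variation of bending energy and holonomy -/

section Variation

variable {ε : ℝ} {g : ℝ → ℝ → E3}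

/-- The curve at parameter `0` has unit speed, so nearby curves are regular, uniformly on `[a, b]`.
The parameter range is shrunk until the speed can be divided by. -/
theorem exists_smoothFamily_unitTangent (hab : a < b) (hγ1 : IsArcLengthParam a b γ)
    (hε : 0 < ε) (hg : SmoothFamily ε a b g) (h0 : ∀ x ∈ Icc a b, g 0 x = γ x) :
    ∃ ε' > 0, ε' ≤ ε ∧ (∀ t ∈ Icc (-ε') ε', ∀ x ∈ Icc a b, D a b (g t) x ≠ 0) ∧
      SmoothFamily ε' a b (fun t => unitTangent a b (g t)) := by
  obtain ⟨ε', hε', hle, h⟩ := (hg.D hε hab).exists_forall_mem hε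
    (isOpen_compl_singleton (x := (0 : E3))) fun x hx => by
      rw [mem_compl_singleton_iff, ← norm_ne_zero_iff, D_congr h0 hx, hγ1 x hx]
      norm_num
  exact ⟨ε', hε', hle, h, ((hg.D hε hab).mono hle).normalize h⟩

/-- To first order, a variation constrains arc-length iff `⟨Y', T⟩ = 0`, with `Y` the
variation field. -/
theorem ConstrainsArcLength.inner_eq_zero (hab : a < b) (hγ1 : IsArcLengthParam a b γ)
    (hε : 0 < ε) (hg : SmoothFamily ε a b g) (h0 : ∀ x ∈ Icc a b, g 0 x = γ x)
    (hc : ConstrainsArcLength a b g) {x : ℝ} (hx : x ∈ Icc a b) :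
    ⟪unitTangent a b γ x, D a b (paramDeriv g) x⟫_ℝ = 0 := by
  have h := hasDerivAt_norm_of_norm_eq_one (hg.hasDerivAt_D hε hab hx)
    (by rw [D_congr h0 hx, hγ1 x hx])
  rw [hγ1.unitTangent_eq hx, ← D_congr h0 hx]
  exact h.unique (hc x hx)

theorem hasDerivAt_unitTangent (hab : a < b) (hγ1 : IsArcLengthParam a b γ)
    (hε : 0 < ε) (hg : SmoothFamily ε a b g) (h0 : ∀ x ∈ Icc a b, g 0 x = γ x)
    (hc : ConstrainsArcLength a b g) {x : ℝ} (hx : x ∈ Icc a b) :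
    HasDerivAt (fun t => unitTangent a b (g t) x) (D a b (paramDeriv g) x) 0 := by
  have h := hc.inner_eq_zero hab hγ1 hε hg h0 hx
  rw [hγ1.unitTangent_eq hx, ← D_congr h0 hx] at h
  exact hasDerivAt_normalize (hg.hasDerivAt_D hε hab hx) (by rw [D_congr h0 hx, hγ1 x hx]) h

theorem unitTangent_zero (h0 : ∀ x ∈ Icc a b, g 0 x = γ x) {x : ℝ} (hx : x ∈ Icc a b) :
    unitTangent a b (g 0) x = unitTangent a b γ x := by
  simp only [unitTangent, arcDeriv, D_congr h0 hx]

/-- The first variation of the bending energy under variations that constrain arc-length. -/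
theorem hasDerivAt_bendingEnergy (hab : a < b) (hγ1 : IsArcLengthParam a b γ)
    {ϱ : ℝ → ℝ} (hϱ : SmoothOn a b ϱ)
    (hε : 0 < ε) (hg : SmoothFamily ε a b g) (h0 : ∀ x ∈ Icc a b, g 0 x = γ x)
    (hc : ConstrainsArcLength a b g) :
    HasDerivAt (fun t => bendingEnergy a b ϱ (g t))
      (∫ x in a..b, ϱ x * ⟪D a b (unitTangent a b γ) x, D a b (D a b (paramDeriv g)) x⟫_ℝ) 0 := by
  obtain ⟨r, hr, hle, hne, hT⟩ := exists_smoothFamily_unitTangent hab hγ1 hε hg h0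
  have hG := (hg.D hε hab).mono hle
  have hn : SmoothFamily r a b (fun t x => ‖D a b (g t) x‖) :=
    ContDiffOn.norm ℝ hG fun p hp => hne p.1 hp.1 p.2 hp.2
  have hA : SmoothFamily r a b (fun t => arcDeriv a b (g t) (unitTangent a b (g t))) :=
    (ContDiffOn.inv hn fun p hp => norm_ne_zero_iff.2 (hne p.1 hp.1 p.2 hp.2)).smul (hT.D hr hab)
  have hF := ((hϱ.family r).mul (ContDiffOn.inner ℝ hA hA)).mul hn
  have hI := (SmoothFamily.hasDerivAt_integral (F := fun t x => ϱ x *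
    ⟪arcDeriv a b (g t) (unitTangent a b (g t)) x,
      arcDeriv a b (g t) (unitTangent a b (g t)) x⟫_ℝ * ‖D a b (g t) x‖) hF hr hab).const_mul
    (1 / 2 : ℝ)
  convert! hI using 1
  rw [← intervalIntegral.integral_const_mul]
  refine intervalIntegral.integral_congr fun x hx => ?_
  rw [uIcc_of_le hab.le] at hx
  -- The derivatives in `t` and `x` are exchanged, and `T` varies by `Y'`; hence `T'` varies by
  -- `Y''`.
  have e1 : HasDerivAt (fun t => D a b (unitTangent a b (g t)) x)
      (D a b (D a b (paramDeriv g)) x) 0 := by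
    rw [← D_congr (fun y hy => (hasDerivAt_unitTangent hab hγ1 hε hg h0 hc hy).deriv) hx]
    exact hT.hasDerivAt_D hr hab hx
  have e2 := hc x hx
  have hn0 : ‖D a b (g 0) x‖ = 1 := by rw [D_congr h0 hx, hγ1 x hx]
  have hT0 : D a b (unitTangent a b (g 0)) x = D a b (unitTangent a b γ) x :=
    D_congr (fun y hy => unitTangent_zero h0 hy) hx
  -- The speed is `1` with vanishing `t`-derivative, so the arc-length factors contribute nothing
  -- and only the variation of `T'` survives.
  have e3 := (e2.inv (by rw [hn0]; norm_num)).smul e1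
  have e4 := ((e3.inner ℝ e3).const_mul (ϱ x)).mul e2
  have e5 := e4.deriv
  simp only [Pi.smul_apply', Pi.inv_apply, hn0, hT0, inv_one, one_smul, neg_zero, zero_smul, add_zero, mul_zero,
    mul_one, div_one, one_pow] at e5
  change _ = 1 / 2 * deriv _ 0
  refine Eq.trans ?_ (congrArg (fun z => 1 / 2 * z) e5.symm)
  rw [real_inner_comm (D a b (unitTangent a b γ) x)]
  ring

/-- The holonomy along a compactly supported variation that constrains arc-length has a lift
which is differentiable at `0`, with an explicit derivative. -/
theorem exists_hasDerivAt_isHolonomy (hab : a < b) (hγ : SmoothOn a b γ)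
    (hγ1 : IsArcLengthParam a b γ)
    {N : ℝ → E3} (hN : IsParallelNormalField a b γ N) (hN1 : ∀ x ∈ Icc a b, ‖N x‖ = 1)
    {Wa Wb : E3} (hW : IsNormalPair a b γ Wa Wb) (hg : IsVariation a b γ g)
    (hc : ConstrainsArcLength a b g) :
    ∃ θ : ℝ → ℝ, (∀ᶠ t in 𝓝 (0 : ℝ), IsHolonomy a b (g t) Wa Wb (θ t : Real.Angle)) ∧
      HasDerivAt θ (∫ x in a..b, ⟪D a b (unitTangent a b γ) x,
        cross (unitTangent a b γ x) (D a b (paramDeriv g) x)⟫_ℝ) 0 := by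
  obtain ⟨ε, hε, hg, h0, δ, hδ, hfix⟩ := hg
  replace hg : SmoothFamily ε a b g := hg
  obtain ⟨r, hr, hle, hne, hT⟩ := exists_smoothFamily_unitTangent hab hγ1 hε hg h0
  have ha : a ∈ Icc a b := ⟨le_rfl, hab.le⟩
  have hb : b ∈ Icc a b := ⟨hab.le, le_rfl⟩
  -- Projecting the fixed field `N` off the moving tangent gives a normal field along each curve,
  -- smooth in `t` and equal to `N` at `t = 0`. It need not be parallel for `t ≠ 0`; its twist `q`
  -- measures the defect.
  set A : ℝ → ℝ → E3 := fun t x =>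
    N x - ⟪N x, unitTangent a b (g t) x⟫_ℝ • unitTangent a b (g t) x with hA_def
  have hA : SmoothFamily r a b A := (hN.smooth.family r).sub
    ((ContDiffOn.inner ℝ (hN.smooth.family r) hT).smul hT)
  have hA0 : ∀ x ∈ Icc a b, A 0 x = N x := fun x hx => by
    simp only [hA_def, unitTangent_zero h0 hx, hN.normal x hx, zero_smul, sub_zero]
  obtain ⟨s, hs, hsr, hAne⟩ := hA.exists_forall_mem hr
    (isOpen_compl_singleton (x := (0 : E3))) fun x hx => by
      rw [mem_compl_singleton_iff, ← norm_ne_zero_iff, hA0 x hx, hN1 x hx]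
      norm_num
  set M : ℝ → ℝ → E3 := fun t x => ‖A t x‖⁻¹ • A t x with hM_def
  have hM : SmoothFamily s a b M := (hA.mono hsr).normalize hAne
  have hTs := hT.mono hsr
  have hM0 : ∀ x ∈ Icc a b, M 0 x = N x := fun x hx => by
    simp [hM_def, hA0 x hx, hN1 x hx]
  -- the time derivative of the normal field `M`
  have hMd : ∀ x ∈ Icc a b, HasDerivAt (fun t => M t x)
      (-⟪N x, D a b (paramDeriv g) x⟫_ℝ • unitTangent a b γ x) 0 := fun x hx => by
    have h1 := hasDerivAt_unitTangent hab hγ1 hε hg h0 hc hx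
    have h2 := (((hasDerivAt_const (0 : ℝ) (N x)).inner ℝ h1).smul h1).const_sub (N x)
    simp only [unitTangent_zero h0 hx, hN.normal x hx, zero_smul, zero_add, inner_zero_left,
      add_zero, ← neg_smul] at h2
    exact hasDerivAt_normalize h2 (by
      change ‖A 0 x‖ = 1
      rw [hA0 x hx, hN1 x hx]) (by
      change ⟪A 0 x, _⟫_ℝ = 0
      rw [hA0 x hx, inner_smul_right, hN.normal x hx, mul_zero])
  obtain ⟨α, hα⟩ := exists_angle (hγ1.norm_unitTangent ha) (hN1 a ha) (hN.normal a ha)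
    hW.norm_left hW.normal_left
  obtain ⟨β, hβ⟩ := exists_angle (hγ1.norm_unitTangent hb) (hN1 b hb) (hN.normal b hb)
    hW.norm_right hW.normal_right
  set q : ℝ → ℝ → ℝ := fun t x =>
    ⟪D a b (M t) x, cross (unitTangent a b (g t) x) (M t x)⟫_ℝ with hq_def
  -- The transport of `Wa` starts at angle `α` from `M t` and arrives at angle `α - ∫ q`. As `Wb`
  -- lies at angle `β` from `M t b = N b`, the holonomy is the difference of these angles.
  refine ⟨fun t => α - (∫ x in a..b, q t x) - β, ?_, ?_⟩
  · filter_upwards [Icc_mem_nhds (neg_lt_zero.2 hs) hs] with t ht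
    have htr : t ∈ Icc (-r) r := ⟨by linarith [ht.1], by linarith [ht.2]⟩
    have htε : t ∈ Icc (-ε) ε := ⟨by linarith [ht.1], by linarith [ht.2]⟩
    have hT1 : ∀ x ∈ Icc a b, ‖unitTangent a b (g t) x‖ = 1 := fun x hx =>
      norm_unitTangent (hne t htr x hx)
    -- The variation is fixed near the ends, so there the tangents, and with them `M t`, do not
    -- depend on `t`.
    have hTa : unitTangent a b (g t) a = unitTangent a b γ a := by
      refine unitTangent_congr ha ?_
      filter_upwards [self_mem_nhdsWithin, mem_nhdsWithin_of_mem_nhds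
        (Iio_mem_nhds (by linarith : a < a + δ))] with y hy hy'
      exact hfix t htε y hy (Or.inl (le_of_lt hy'))
    have hTb : unitTangent a b (g t) b = unitTangent a b γ b := by
      refine unitTangent_congr hb ?_
      filter_upwards [self_mem_nhdsWithin, mem_nhdsWithin_of_mem_nhds
        (Ioi_mem_nhds (by linarith : b - δ < b))] with y hy hy'
      exact hfix t htε y hy (Or.inr (le_of_lt hy'))
    have hMa : M t a = N a := by
      simp [hM_def, hA_def, hTa, hN.normal a ha, hN1 a ha]
    have hMb : M t b = N b := by
      simp [hM_def, hA_def, hTb, hN.normal b hb, hN1 b hb]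
    have hMT : ∀ x ∈ Icc a b, ⟪M t x, unitTangent a b (g t) x⟫_ℝ = 0 := fun x hx => by
      simp only [hM_def, hA_def, inner_smul_left, inner_sub_left, real_inner_self_eq_norm_sq,
        hT1 x hx]
      simp
    obtain ⟨Z, hZ, hZa, hZb⟩ := exists_isParallelNormalField hab (hTs.apply ht) hT1
      (hM.apply ht) (fun x hx => norm_normalize (hAne t ht x hx)) hMT α
    refine ⟨Z, hZ, ?_, ?_⟩
    · rw [hZa, hMa, hTa, ← hα]
    · rw [hZb, hMb, hTb, Real.Angle.cos_coe, Real.Angle.sin_coe, hβ, cross_add_right,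
        cross_smul_right, cross_smul_right,
        cross_cross_of_orthonormal (hγ1.norm_unitTangent hb) (hN.normal b hb)]
      change Real.cos (α - ∫ x in a..b, q t x) • _ + Real.sin (α - ∫ x in a..b, q t x) • _ = _
      set φ := α - ∫ x in a..b, q t x
      have hφ : φ = (φ - β) + β := by ring
      rw [hφ, Real.cos_add (φ - β) β, Real.sin_add (φ - β) β, ← hφ]
      module
  · have hq : SmoothFamily s a b q :=
      ContDiffOn.inner ℝ (hM.D hs hab) (ContDiffOn.cross hTs hM)
    have hI := ((hq.hasDerivAt_integral hs hab).const_sub α).sub_const β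
    convert! hI using 1
    rw [← intervalIntegral.integral_neg]
    refine intervalIntegral.integral_congr fun x hx => ?_
    rw [uIcc_of_le hab.le] at hx
    have hTγ := hγ1.smoothOn_unitTangent hab hγ
    have hξ := (hg.smoothOn_paramDeriv hε hab).D hab
    have e1 := hM.hasDerivAt_D hs hab hx
    have e2 := (hasDerivAt_unitTangent hab hγ1 hε hg h0 hc hx).cross (hMd x hx)
    have e3 := (e1.inner ℝ e2).deriv
    have hDM0 : D a b (M 0) x = D a b N x := D_congr hM0 hx
    have hd : SmoothOn a b fun y => -⟪N y, D a b (paramDeriv g) y⟫_ℝ :=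
      (ContDiffOn.inner ℝ hN.smooth hξ).neg
    -- `M` varies by the tangential field `-⟨N, ξ⟩T`. In the derivative of `q` it is paired, after
    -- differentiation in `x`, with `T × N`, so only the summand containing `T'` will count.
    have hDdot : D a b (paramDeriv M) x =
        -⟪N x, D a b (paramDeriv g) x⟫_ℝ • D a b (unitTangent a b γ) x +
          D a b (fun y => -⟪N y, D a b (paramDeriv g) y⟫_ℝ) x • unitTangent a b γ x := by
      refine (D_congr (f := paramDeriv M) (fun y hy => (hMd y hy).deriv) hx).trans ?_
      exact D_eq hab hx ((hd.hasDerivWithinAt hx).smul (hTγ.hasDerivWithinAt hx))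
    obtain ⟨l, -, hl⟩ := hN.parallel
    have hl' : l x = -⟪N x, D a b (unitTangent a b γ) x⟫_ℝ := by
      rw [← inner_D_eq_neg hab hN.smooth hTγ hN.normal hx, hl x hx, inner_smul_left,
        real_inner_self_eq_norm_sq, hγ1.norm_unitTangent hx]
      simp
    change _ = -deriv _ 0
    refine Eq.trans ?_ (congrArg Neg.neg e3.symm)
    have hTN : ⟪unitTangent a b γ x, cross (unitTangent a b γ x) (N x)⟫_ℝ = 0 := by
      rw [real_inner_comm]; exact inner_cross_self_left _ _
    simp only [hDM0, hDdot, unitTangent_zero h0 hx, hM0 x hx, hl x hx, hl', inner_add_right,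
      inner_add_left, inner_smul_left, inner_smul_right, cross_smul_right, cross_self, hTN,
      inner_zero_right, conj_trivial]
    set T := unitTangent a b γ x
    set T' := D a b (unitTangent a b γ) x
    set ξ := D a b (paramDeriv g) x
    have hTξ : ⟪ξ, T⟫_ℝ = 0 := by
      rw [real_inner_comm]; exact hc.inner_eq_zero hab hγ1 hε hg h0 hx
    -- What remains is `⟨ξ, N⟩⟨T', T × N⟩ - ⟨ξ, T × N⟩⟨T', N⟩`, recognized as `⟨T', T × ξ⟩` by
    -- expanding `ξ` in the frame.
    have hexp : ξ = ⟪ξ, T⟫_ℝ • T + ⟪ξ, N x⟫_ℝ • N x + ⟪ξ, cross T (N x)⟫_ℝ • cross T (N x) :=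
      eq_sum_inner_smul (hγ1.norm_unitTangent hx) (hN1 x hx) (hN.normal x hx) ξ
    have hTTN : cross T (cross T (N x)) = -N x :=
      cross_cross_of_orthonormal (hγ1.norm_unitTangent hx) (hN.normal x hx)
    have e4 := congrArg (fun v => ⟪T', cross T v⟫_ℝ) hexp
    simp only [cross_add_right, cross_smul_right, cross_self, inner_add_right, inner_smul_right,
      hTTN, inner_neg_right, hTξ, zero_mul, zero_add] at e4
    change ⟪T', cross T ξ⟫_ℝ = _
    rw [e4, inner_cross_swap T ξ (N x), real_inner_comm (N x) T',
      real_inner_comm ξ (N x)]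
    ring

/-- A lift of the holonomy has the same derivative as any other differentiable lift. -/
theorem IsHolonomy.eq_of_hasDerivAt (hab : a < b) {Wa Wb : E3} (hWb : ‖Wb‖ = 1)
    (hWT : ∀ᶠ t in 𝓝 (0 : ℝ), ⟪Wb, unitTangent a b (g t) b⟫_ℝ = 0 ∧ ‖unitTangent a b (g t) b‖ = 1)
    {θ₁ θ₂ : ℝ → ℝ} {d₁ d₂ : ℝ}
    (h₁ : ∀ᶠ t in 𝓝 (0 : ℝ), IsHolonomy a b (g t) Wa Wb (θ₁ t : Real.Angle))
    (h₂ : ∀ᶠ t in 𝓝 (0 : ℝ), IsHolonomy a b (g t) Wa Wb (θ₂ t : Real.Angle))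
    (hd₁ : HasDerivAt θ₁ d₁ 0) (hd₂ : HasDerivAt θ₂ d₂ 0) : d₁ = d₂ := by
  have key : ∀ᶠ t in 𝓝 (0 : ℝ), Real.cos (θ₁ t) = Real.cos (θ₂ t) ∧
      Real.sin (θ₁ t) = Real.sin (θ₂ t) := by
    filter_upwards [hWT, h₁, h₂] with t ⟨hn, hT⟩ ⟨Z₁, hZ₁, ha₁, hb₁⟩ ⟨Z₂, hZ₂, ha₂, hb₂⟩
    have h := hZ₁.eq_of_eq_left hab hZ₂ (ha₁.trans ha₂.symm)
    rw [hb₁, hb₂] at h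
    simp only [Real.Angle.cos_coe, Real.Angle.sin_coe] at h
    have i1 := inner_cross_self_right (unitTangent a b (g t) b) Wb
    have i2 : ⟪Wb, cross (unitTangent a b (g t) b) Wb⟫_ℝ = 0 := by rw [real_inner_comm, i1]
    constructor
    · have := congrArg (fun v => ⟪v, Wb⟫_ℝ) h
      simpa [inner_add_left, inner_smul_left, i1, hWb] using this
    · have := congrArg (fun v => ⟪v, cross (unitTangent a b (g t) b) Wb⟫_ℝ) h
      simpa [inner_add_left, inner_smul_left, i2, norm_cross_of_orthonormal hT hWb hn] using this
  -- The lifts agree only modulo `2π` and may jump away from `0`. Applying the sine removes the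
  -- ambiguity, and its derivative at `0` is `d₁ - d₂` because the cosine of the difference is `1`
  -- there.
  have hs : (fun t => Real.sin (θ₁ t - θ₂ t)) =ᶠ[𝓝 0] fun _ => 0 := by
    filter_upwards [key] with t ⟨hc, hs⟩
    rw [Real.sin_sub, hc, hs]
    ring
  have h0 : Real.cos (θ₁ 0 - θ₂ 0) = 1 := by
    obtain ⟨hc, hs⟩ := key.self_of_nhds
    rw [Real.cos_sub, hc, hs, ← sq, ← sq, Real.cos_sq_add_sin_sq]
  have h := ((hd₁.sub hd₂).sin).unique ((hasDerivAt_const (0 : ℝ) (0 : ℝ)).congr_of_eventuallyEq hs)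
  rw [Pi.sub_apply, h0, one_mul] at h
  linarith

end Variation

/-! ### Test functions and Lagrange multipliers -/

section LagrangeMultipliers

/-- Smooth functions with compact support in the open interval `(a, b)`. -/
def testSpace (a b : ℝ) : Submodule ℝ (ℝ → ℝ) where
  carrier := {u | ContDiff ℝ ∞ u ∧ HasCompactSupport u ∧ tsupport u ⊆ Ioo a b}
  zero_mem' := ⟨contDiff_const, HasCompactSupport.zero, by simp [tsupport_eq_empty_iff.2 rfl]⟩
  add_mem' := fun {u v} hu hv => ⟨hu.1.add hv.1, hu.2.1.add hv.2.1,
    (tsupport_add u v).trans (union_subset hu.2.2 hv.2.2)⟩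
  smul_mem' := fun r u hu => ⟨contDiff_const.smul hu.1, hu.2.1.smul_left (f := fun _ => r),
    (tsupport_smul_subset_right (fun _ => r) u).trans hu.2.2⟩

variable {a b : ℝ}

theorem intervalIntegrable_testSpace_mul (hab : a < b) {f u : ℝ → ℝ}
    (hf : ContinuousOn f (Icc a b)) (hu : u ∈ testSpace a b) :
    IntervalIntegrable (fun x => u x * f x) MeasureTheory.volume a b :=
  ContinuousOn.intervalIntegrable (by
    rw [uIcc_of_le hab.le]; exact hu.1.continuous.continuousOn.mul hf)

/-- Integration of a pair of test functions against a pair of continuous functions. -/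
def testFunctional (hab : a < b) (f₁ f₂ : ℝ → ℝ) (h₁ : ContinuousOn f₁ (Icc a b))
    (h₂ : ContinuousOn f₂ (Icc a b)) : (testSpace a b × testSpace a b) →ₗ[ℝ] ℝ where
  toFun p := (∫ x in a..b, p.1.1 x * f₁ x) + ∫ x in a..b, p.2.1 x * f₂ x
  map_add' p q := by
    simp only [Prod.fst_add, Prod.snd_add, Submodule.coe_add, Pi.add_apply, add_mul]
    rw [intervalIntegral.integral_add (intervalIntegrable_testSpace_mul hab h₁ p.1.2)
        (intervalIntegrable_testSpace_mul hab h₁ q.1.2),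
      intervalIntegral.integral_add (intervalIntegrable_testSpace_mul hab h₂ p.2.2)
        (intervalIntegrable_testSpace_mul hab h₂ q.2.2)]
    ring
  map_smul' r p := by
    simp only [Prod.smul_fst, Prod.smul_snd, Submodule.coe_smul, Pi.smul_apply, smul_eq_mul,
      mul_assoc, intervalIntegral.integral_const_mul, RingHom.id_apply]
    ring

/-- The fundamental lemma of the calculus of variations on `[a, b]`. -/
theorem eq_zero_of_integral_testSpace (hab : a < b) {f : ℝ → ℝ} (hf : ContinuousOn f (Icc a b))
    (h : ∀ u ∈ testSpace a b, ∫ x in a..b, u x * f x = 0) : ∀ x ∈ Icc a b, f x = 0 := by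
  have h1 : ∀ᵐ x, x ∈ Ioo a b → f x = 0 := by
    refine isOpen_Ioo.ae_eq_zero_of_integral_contDiff_smul_eq_zero
      ((hf.mono Ioo_subset_Icc_self).locallyIntegrableOn measurableSet_Ioo) fun u hu hc hs => ?_
    have := h u ⟨hu, hc, hs⟩
    rwa [intervalIntegral.integral_eq_integral_of_support_subset] at this
    exact (Function.support_mul_subset_left u f).trans
      ((subset_tsupport u).trans (hs.trans Ioo_subset_Ioc_self))
  refine MeasureTheory.Measure.eqOn_Icc_of_ae_eq MeasureTheory.volume hab.ne ?_ hf
    continuousOn_const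
  rw [← MeasureTheory.restrict_Ioo_eq_restrict_Icc]
  exact (MeasureTheory.ae_restrict_iff' measurableSet_Ioo).2 h1

/-- Lagrange multipliers for finitely many integral constraints. -/
theorem exists_multipliers {ι : Type*} [Fintype ι] (hab : a < b) {f₁ f₂ : ℝ → ℝ}
    {w₁ w₂ : ι → ℝ → ℝ} (hf₁ : ContinuousOn f₁ (Icc a b)) (hf₂ : ContinuousOn f₂ (Icc a b))
    (hw₁ : ∀ i, ContinuousOn (w₁ i) (Icc a b)) (hw₂ : ∀ i, ContinuousOn (w₂ i) (Icc a b))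
    (h : ∀ u ∈ testSpace a b, ∀ v ∈ testSpace a b,
      (∀ i, (∫ x in a..b, u x * w₁ i x) + ∫ x in a..b, v x * w₂ i x = 0) →
      (∫ x in a..b, u x * f₁ x) + ∫ x in a..b, v x * f₂ x = 0) :
    ∃ c : ι → ℝ, ∀ x ∈ Icc a b, f₁ x = ∑ i, c i * w₁ i x ∧ f₂ x = ∑ i, c i * w₂ i x := by
  -- Pure linear algebra: a functional vanishing on the common kernel of finitely many functionals
  -- is a linear combination of them. No topology on the test space is needed.
  have hmem : testFunctional hab f₁ f₂ hf₁ hf₂ ∈ Submodule.span ℝ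
      (range fun i => testFunctional hab (w₁ i) (w₂ i) (hw₁ i) (hw₂ i)) := by
    refine mem_span_of_iInf_ker_le_ker fun p hp => ?_
    simp only [Submodule.mem_iInf, LinearMap.mem_ker] at hp ⊢
    exact h _ p.1.2 _ p.2.2 hp
  obtain ⟨c, hc⟩ := (Submodule.mem_span_range_iff_exists_fun ℝ).1 hmem
  have key : ∀ {f : ℝ → ℝ} {w : ι → ℝ → ℝ}, ContinuousOn f (Icc a b) →
      (∀ i, ContinuousOn (w i) (Icc a b)) →
      (∀ u ∈ testSpace a b, ∑ i, c i * ∫ x in a..b, u x * w i x = ∫ x in a..b, u x * f x) →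
      ∀ x ∈ Icc a b, f x = ∑ i, c i * w i x := by
    intro f w hf hw hi x hx
    refine sub_eq_zero.1 (eq_zero_of_integral_testSpace hab
      (f := fun x => f x - ∑ i, c i * w i x)
      (hf.sub (continuousOn_finsetSum _ fun i _ => (hw i).const_mul (c i))) (fun u hu => ?_) x hx)
    have hint := fun i => (intervalIntegrable_testSpace_mul hab (hw i) hu).const_mul (c i)
    have e : ∀ x, u x * (f x - ∑ i, c i * w i x) = u x * f x - ∑ i, c i * (u x * w i x) := by
      intro x
      rw [mul_sub, Finset.mul_sum]
      congr 1
      exact Finset.sum_congr rfl fun i _ => by ring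
    simp only [e]
    rw [intervalIntegral.integral_sub (intervalIntegrable_testSpace_mul hab hf hu)
        (by simpa only [Finset.sum_fn] using IntervalIntegrable.sum Finset.univ fun i _ => hint i),
      intervalIntegral.integral_finsetSum fun i _ => hint i, ← hi u hu]
    simp only [intervalIntegral.integral_const_mul, sub_self]
  have hcu : ∀ u ∈ testSpace a b, ∀ v ∈ testSpace a b,
      ∑ i, c i * ((∫ x in a..b, u x * w₁ i x) + ∫ x in a..b, v x * w₂ i x) =
      (∫ x in a..b, u x * f₁ x) + ∫ x in a..b, v x * f₂ x := fun u hu v hv => by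
    have := LinearMap.congr_fun hc (⟨u, hu⟩, ⟨v, hv⟩)
    simpa only [LinearMap.sum_apply, LinearMap.smul_apply, smul_eq_mul] using! this
  -- Pairs with one entry zero separate the two components, with the same coefficients `c`.
  refine ⟨c, fun x hx => ⟨key hf₁ hw₁ (fun u hu => ?_) x hx,
    key hf₂ hw₂ (fun u hu => ?_) x hx⟩⟩
  · simpa using hcu u hu 0 (zero_mem _)
  · simpa using hcu 0 (zero_mem _) u hu

end LagrangeMultipliers

/-! ### Frame equations and the first integral of the Euler-Lagrange system -/

section ParallelFrame

/-- The structure equations `T' = -(k₁ N₁ + k₂ N₂)`, `N₁' = k₁ T`, `N₂' = k₂ T` of an adapted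
orthonormal frame `T, N₁, N₂ = T × N₁`. -/
structure IsAdaptedFrame (a b : ℝ) (T N₁ N₂ : ℝ → E3) (k₁ k₂ : ℝ → ℝ) : Prop where
  smooth_tangent : SmoothOn a b T
  smooth_normal₁ : SmoothOn a b N₁
  smooth_normal₂ : SmoothOn a b N₂
  smooth_curvature₁ : SmoothOn a b k₁
  smooth_curvature₂ : SmoothOn a b k₂
  norm_tangent : ∀ x ∈ Icc a b, ‖T x‖ = 1
  norm_normal₁ : ∀ x ∈ Icc a b, ‖N₁ x‖ = 1
  norm_normal₂ : ∀ x ∈ Icc a b, ‖N₂ x‖ = 1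
  normal₁ : ∀ x ∈ Icc a b, ⟪N₁ x, T x⟫_ℝ = 0
  normal₂ : ∀ x ∈ Icc a b, ⟪N₂ x, T x⟫_ℝ = 0
  orthogonal : ∀ x ∈ Icc a b, ⟪N₁ x, N₂ x⟫_ℝ = 0
  cross_normal₁ : ∀ x ∈ Icc a b, cross (T x) (N₁ x) = N₂ x
  cross_normal₂ : ∀ x ∈ Icc a b, cross (T x) (N₂ x) = -N₁ x
  D_tangent : ∀ x ∈ Icc a b, D a b T x = -(k₁ x • N₁ x + k₂ x • N₂ x)
  D_normal₁ : ∀ x ∈ Icc a b, D a b N₁ x = k₁ x • T x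
  D_normal₂ : ∀ x ∈ Icc a b, D a b N₂ x = k₂ x • T x

variable {a b : ℝ} {γ : ℝ → E3}

theorem IsParallelFrame.isAdaptedFrame (hab : a < b) (hγ : SmoothOn a b γ)
    (hγ1 : IsArcLengthParam a b γ) {N₁ N₂ : ℝ → E3} (hN : IsParallelFrame a b γ N₁ N₂)
    {k₁ k₂ : ℝ → ℝ}
    (hk : ∀ x ∈ Icc a b, D a b (unitTangent a b γ) x = -(k₁ x • N₁ x + k₂ x • N₂ x)) :
    IsAdaptedFrame a b (unitTangent a b γ) N₁ N₂ k₁ k₂ := by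
  have hT := hγ1.smoothOn_unitTangent hab hγ
  have hT1 := fun x hx => hγ1.norm_unitTangent (x := x) hx
  have hc : ∀ x ∈ Icc a b, N₂ x = cross (unitTangent a b γ x) (N₁ x) := fun x hx =>
    eq_cross_of_det_eq_one (hT1 x hx) (hN.unit₁ x hx) (hN.parallel₁.normal x hx)
      (hN.unit₂ x hx) (hN.det_eq_one x hx)
  have ho : ∀ x ∈ Icc a b, ⟪N₁ x, N₂ x⟫_ℝ = 0 := fun x hx => by
    rw [hc x hx, real_inner_comm, inner_cross_self_right]
  -- Smoothness of the curvatures is not assumed; it follows from these formulas. They also identify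
  -- the factor in `Nᵢ' = lT`, since differentiating `⟨Nᵢ, T⟩ = 0` gives `l = -⟨Nᵢ, T'⟩`.
  have hk₁ : ∀ x ∈ Icc a b, k₁ x = -⟪N₁ x, D a b (unitTangent a b γ) x⟫_ℝ := fun x hx => by
    rw [hk x hx, inner_neg_right, inner_add_right, inner_smul_right, inner_smul_right, ho x hx,
      real_inner_self_eq_norm_sq, hN.unit₁ x hx]
    ring
  have hk₂ : ∀ x ∈ Icc a b, k₂ x = -⟪N₂ x, D a b (unitTangent a b γ) x⟫_ℝ := fun x hx => by
    rw [hk x hx, inner_neg_right, inner_add_right, inner_smul_right, inner_smul_right,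
      real_inner_comm, ho x hx, real_inner_self_eq_norm_sq, hN.unit₂ x hx]
    ring
  have hD : ∀ {N : ℝ → E3}, IsParallelNormalField a b γ N → ∀ x ∈ Icc a b,
      D a b N x = -⟪N x, D a b (unitTangent a b γ) x⟫_ℝ • unitTangent a b γ x := by
    intro N hN x hx
    obtain ⟨l, -, hl⟩ := hN.parallel
    rw [← inner_D_eq_neg hab hN.smooth hT hN.normal hx, hl x hx, inner_smul_left,
      real_inner_self_eq_norm_sq, hT1 x hx]
    simp
  exact
  { smooth_tangent := hT
    smooth_normal₁ := hN.parallel₁.smooth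
    smooth_normal₂ := hN.parallel₂.smooth
    smooth_curvature₁ := SmoothOn.congr
      (ContDiffOn.inner ℝ hN.parallel₁.smooth (hT.D hab)).neg hk₁
    smooth_curvature₂ := SmoothOn.congr
      (ContDiffOn.inner ℝ hN.parallel₂.smooth (hT.D hab)).neg hk₂
    norm_tangent := hT1
    norm_normal₁ := hN.unit₁
    norm_normal₂ := hN.unit₂
    normal₁ := hN.parallel₁.normal
    normal₂ := hN.parallel₂.normal
    orthogonal := ho
    cross_normal₁ := fun x hx => (hc x hx).symm
    cross_normal₂ := fun x hx => by
      rw [hc x hx, cross_cross_of_orthonormal (hT1 x hx) (hN.parallel₁.normal x hx)]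
    D_tangent := hk
    D_normal₁ := fun x hx => by rw [hD hN.parallel₁ x hx, hk₁ x hx]
    D_normal₂ := fun x hx => by rw [hD hN.parallel₂ x hx, hk₂ x hx] }

variable {T N₁ N₂ : ℝ → E3} {k₁ k₂ ϱ : ℝ → ℝ}

theorem IsAdaptedFrame.eq_sum (h : IsAdaptedFrame a b T N₁ N₂ k₁ k₂) {x : ℝ} (hx : x ∈ Icc a b)
    {ξ : E3} (hξ : ⟪T x, ξ⟫_ℝ = 0) : ξ = ⟪ξ, N₁ x⟫_ℝ • N₁ x + ⟪ξ, N₂ x⟫_ℝ • N₂ x := by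
  have := eq_sum_inner_smul (h.norm_tangent x hx) (h.norm_normal₁ x hx) (h.normal₁ x hx) ξ
  rwa [h.cross_normal₁ x hx, real_inner_comm (T x) ξ, hξ, zero_smul, zero_add] at this

/-- The derivative of `ϱ T'` in terms of the curvatures. -/
theorem IsAdaptedFrame.D_smul_D_tangent (h : IsAdaptedFrame a b T N₁ N₂ k₁ k₂) (hab : a < b)
    (hϱ : SmoothOn a b ϱ) {x : ℝ} (hx : x ∈ Icc a b) :
    D a b (fun y => ϱ y • D a b T y) x =
      -(D a b (fun y => ϱ y * k₁ y) x • N₁ x + D a b (fun y => ϱ y * k₂ y) x • N₂ x) -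
        (ϱ x * (k₁ x * k₁ x + k₂ x * k₂ x)) • T x := by
  have e : ∀ y ∈ Icc a b, ϱ y • D a b T y =
      -((ϱ y * k₁ y) • N₁ y + (ϱ y * k₂ y) • N₂ y) := fun y hy => by
    rw [h.D_tangent y hy]; module
  have hp₁ : SmoothOn a b fun y => ϱ y * k₁ y := ContDiffOn.mul hϱ h.smooth_curvature₁
  have hp₂ : SmoothOn a b fun y => ϱ y * k₂ y := ContDiffOn.mul hϱ h.smooth_curvature₂
  refine (D_congr e hx).trans ((D_eq hab hx
    (((hp₁.hasDerivWithinAt hx).smul (h.smooth_normal₁.hasDerivWithinAt hx)).add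
      ((hp₂.hasDerivWithinAt hx).smul (h.smooth_normal₂.hasDerivWithinAt hx))).neg).trans ?_)
  rw [h.D_normal₁ x hx, h.D_normal₂ x hx]
  module

/-- The first integral of the Euler-Lagrange system. The normal part of `(ϱ T')'` is the normal part
of `c - μ T × T'` for a constant vector `c`. -/
def HasFirstIntegral (a b : ℝ) (T : ℝ → E3) (ϱ : ℝ → ℝ) (c : E3) (μ : ℝ) : Prop :=
  ∀ x ∈ Icc a b, ∀ ξ : E3, ⟪T x, ξ⟫_ℝ = 0 →
    ⟪D a b (fun y => ϱ y • D a b T y) x, ξ⟫_ℝ = ⟪c, ξ⟫_ℝ + μ * ⟪D a b T x, cross (T x) ξ⟫_ℝ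

/-- Both sides of the first integral are linear in `ξ`, and `N₁, N₂` span the normal plane, so these
two test vectors suffice. -/
theorem IsAdaptedFrame.hasFirstIntegral_iff (h : IsAdaptedFrame a b T N₁ N₂ k₁ k₂) (hab : a < b)
    (hϱ : SmoothOn a b ϱ) {c : E3} {μ : ℝ} :
    HasFirstIntegral a b T ϱ c μ ↔ ∀ x ∈ Icc a b,
      D a b (fun y => ϱ y * k₁ y) x = -⟪c, N₁ x⟫_ℝ + μ * k₂ x ∧
      D a b (fun y => ϱ y * k₂ y) x = -⟪c, N₂ x⟫_ℝ - μ * k₁ x := by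
  have hT₁ : ∀ x ∈ Icc a b, ⟪T x, N₁ x⟫_ℝ = 0 := fun x hx => by
    rw [real_inner_comm, h.normal₁ x hx]
  have hT₂ : ∀ x ∈ Icc a b, ⟪T x, N₂ x⟫_ℝ = 0 := fun x hx => by
    rw [real_inner_comm, h.normal₂ x hx]
  have ho : ∀ x ∈ Icc a b, ⟪N₂ x, N₁ x⟫_ℝ = 0 := fun x hx => by
    rw [real_inner_comm, h.orthogonal x hx]
  have l₁ : ∀ x ∈ Icc a b, ⟪D a b (fun y => ϱ y • D a b T y) x, N₁ x⟫_ℝ =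
      -D a b (fun y => ϱ y * k₁ y) x := fun x hx => by
    rw [h.D_smul_D_tangent hab hϱ hx]
    simp [inner_sub_left, inner_add_left, inner_smul_left, h.norm_normal₁ x hx, ho x hx, hT₁ x hx]
  have l₂ : ∀ x ∈ Icc a b, ⟪D a b (fun y => ϱ y • D a b T y) x, N₂ x⟫_ℝ =
      -D a b (fun y => ϱ y * k₂ y) x := fun x hx => by
    rw [h.D_smul_D_tangent hab hϱ hx]
    simp [inner_sub_left, inner_add_left, inner_smul_left, h.norm_normal₂ x hx,
      h.orthogonal x hx, hT₂ x hx]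
  have r₁ : ∀ x ∈ Icc a b, ⟪D a b T x, cross (T x) (N₁ x)⟫_ℝ = -k₂ x := fun x hx => by
    rw [h.D_tangent x hx, h.cross_normal₁ x hx]
    simp [inner_add_left, inner_smul_left, h.norm_normal₂ x hx,
      h.orthogonal x hx]
  have r₂ : ∀ x ∈ Icc a b, ⟪D a b T x, cross (T x) (N₂ x)⟫_ℝ = k₁ x := fun x hx => by
    rw [h.D_tangent x hx, h.cross_normal₂ x hx]
    simp [inner_add_left, inner_smul_left, h.norm_normal₁ x hx, ho x hx]
  constructor
  · intro hi x hx
    have h₁ := hi x hx (N₁ x) (hT₁ x hx)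
    have h₂ := hi x hx (N₂ x) (hT₂ x hx)
    rw [l₁ x hx, r₁ x hx] at h₁
    rw [l₂ x hx, r₂ x hx] at h₂
    constructor <;> linarith
  · intro hi x hx ξ hξ
    obtain ⟨h₁, h₂⟩ := hi x hx
    rw [h.eq_sum hx hξ]
    simp only [inner_add_right, inner_smul_right, cross_add_right, cross_smul_right,
      l₁ x hx, l₂ x hx, r₁ x hx, r₂ x hx, h₁, h₂]
    ring

/-- The Euler-Lagrange system of holonomy constrained elastic curves, in components. -/
structure SolvesEulerLagrange (a b : ℝ) (ϱ k₁ k₂ Λ : ℝ → ℝ) (μ : ℝ) : Prop where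
  first : ∀ x ∈ Icc a b, 0 = D a b (D a b (fun y => ϱ y * k₁ y)) x +
    (1 / 2) * ϱ x * (k₁ x * k₁ x + k₂ x * k₂ x) * k₁ x - μ * D a b k₂ x - Λ x * k₁ x
  second : ∀ x ∈ Icc a b, 0 = D a b (D a b (fun y => ϱ y * k₂ y)) x +
    (1 / 2) * ϱ x * (k₁ x * k₁ x + k₂ x * k₂ x) * k₂ x + μ * D a b k₁ x - Λ x * k₂ x
  multiplier : ∀ x ∈ Icc a b,
    0 = D a b Λ x + (1 / 2) * D a b ϱ x * (k₁ x * k₁ x + k₂ x * k₂ x)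

theorem IsAdaptedFrame.exists_solvesEulerLagrange (h : IsAdaptedFrame a b T N₁ N₂ k₁ k₂)
    (hab : a < b) (hϱ : SmoothOn a b ϱ) {c : E3} {μ : ℝ} (hi : HasFirstIntegral a b T ϱ c μ) :
    ∃ Λ : ℝ → ℝ, SmoothOn a b Λ ∧ SolvesEulerLagrange a b ϱ k₁ k₂ Λ μ := by
  rw [h.hasFirstIntegral_iff hab hϱ] at hi
  have hk₁ := fun x hx => h.smooth_curvature₁.hasDerivWithinAt (x := x) hx
  have hk₂ := fun x hx => h.smooth_curvature₂.hasDerivWithinAt (x := x) hx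
  have hc : ∀ {v : ℝ → E3} {x : ℝ}, SmoothOn a b v → x ∈ Icc a b →
      HasDerivWithinAt (fun y => ⟪c, v y⟫_ℝ) ⟪c, D a b v x⟫_ℝ (Icc a b) x := fun hv hx => by
    simpa using (hasDerivWithinAt_const _ _ c).inner ℝ (hv.hasDerivWithinAt hx)
  -- Differentiating `-⟨c, Nᵢ⟩` produces `-⟨c, T⟩kᵢ`. This choice of `Λ` absorbs it together with
  -- the cubic curvature term.
  refine ⟨fun x => -⟪c, T x⟫_ℝ + (1 / 2) * ϱ x * (k₁ x * k₁ x + k₂ x * k₂ x), ?_, ?_, ?_, ?_⟩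
  · exact (contDiffOn_const.inner ℝ h.smooth_tangent).neg.add ((contDiffOn_const.mul hϱ).mul
      ((ContDiffOn.mul h.smooth_curvature₁ h.smooth_curvature₁).add
        (ContDiffOn.mul h.smooth_curvature₂ h.smooth_curvature₂)))
  · intro x hx
    have e := (D_congr (fun y hy => (hi y hy).1) hx).trans (D_eq hab hx
      ((hc h.smooth_normal₁ hx).neg.add ((hk₂ x hx).const_mul μ)))
    rw [h.D_normal₁ x hx, inner_smul_right] at e
    have e' : D a b (D a b fun y => ϱ y * k₁ y) x = _ := e
    rw [e']
    ring
  · intro x hx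
    have e := (D_congr (fun y hy => (hi y hy).2) hx).trans (D_eq hab hx
      ((hc h.smooth_normal₂ hx).neg.sub ((hk₁ x hx).const_mul μ)))
    rw [h.D_normal₂ x hx, inner_smul_right] at e
    have e' : D a b (D a b fun y => ϱ y * k₂ y) x = _ := e
    rw [e']
    ring
  · intro x hx
    have e := D_eq hab hx ((hc h.smooth_tangent hx).neg.add
      (((hϱ.hasDerivWithinAt hx).const_mul (1 / 2 : ℝ)).mul
        (((hk₁ x hx).mul (hk₁ x hx)).add ((hk₂ x hx).mul (hk₂ x hx)))))
    have e' : D a b (fun x => -⟪c, T x⟫_ℝ + (1 / 2) * ϱ x * (k₁ x * k₁ x + k₂ x * k₂ x)) x = _ := e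
    obtain ⟨i₁, i₂⟩ := hi x hx
    have p₁ : D a b (fun y => ϱ y * k₁ y) x = _ :=
      D_eq hab hx ((hϱ.hasDerivWithinAt hx).mul (hk₁ x hx))
    have p₂ : D a b (fun y => ϱ y * k₂ y) x = _ :=
      D_eq hab hx ((hϱ.hasDerivWithinAt hx).mul (hk₂ x hx))
    rw [p₁] at i₁
    rw [p₂] at i₂
    rw [e', h.D_tangent x hx, inner_neg_right, inner_add_right, inner_smul_right, inner_smul_right]
    simp only [Pi.add_apply, Pi.mul_apply]
    -- `-⟨c, T'⟩ = k₁⟨c, N₁⟩ + k₂⟨c, N₂⟩` is evaluated by the first integral; the `μ`-terms cancel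
    -- because `J` is skew.
    linear_combination -k₁ x * i₁ - k₂ x * i₂

/-- The system is a conservation law: its three scalar equations are the vanishing of the three
frame components of `C'` for a suitable vector field `C`. -/
theorem IsAdaptedFrame.exists_hasFirstIntegral (h : IsAdaptedFrame a b T N₁ N₂ k₁ k₂)
    (hab : a < b) (hϱ : SmoothOn a b ϱ) {Λ : ℝ → ℝ} {μ : ℝ} (hΛ : SmoothOn a b Λ)
    (hs : SolvesEulerLagrange a b ϱ k₁ k₂ Λ μ) : ∃ c, HasFirstIntegral a b T ϱ c μ := by
  have hp₁ : SmoothOn a b fun y => ϱ y * k₁ y := ContDiffOn.mul hϱ h.smooth_curvature₁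
  have hp₂ : SmoothOn a b fun y => ϱ y * k₂ y := ContDiffOn.mul hϱ h.smooth_curvature₂
  set p₁ := D a b fun y => ϱ y * k₁ y with hp₁_def
  set p₂ := D a b fun y => ϱ y * k₂ y with hp₂_def
  have hq₁ : SmoothOn a b fun y => p₁ y - μ * k₂ y :=
    ContDiffOn.sub (hp₁.D hab) (contDiffOn_const.mul h.smooth_curvature₂)
  have hq₂ : SmoothOn a b fun y => p₂ y + μ * k₁ y :=
    ContDiffOn.add (hp₂.D hab) (contDiffOn_const.mul h.smooth_curvature₁)
  have hr : SmoothOn a b fun y => Λ y - (1 / 2) * ϱ y * (k₁ y * k₁ y + k₂ y * k₂ y) :=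
    ContDiffOn.sub hΛ ((contDiffOn_const.mul hϱ).mul
      ((ContDiffOn.mul h.smooth_curvature₁ h.smooth_curvature₁).add
        (ContDiffOn.mul h.smooth_curvature₂ h.smooth_curvature₂)))
  -- The normal components are those of `c` solved from the first integral; the tangential one is
  -- solved from `Λ = ½ϱ|κ|² - ⟨c, T⟩`.
  set C : ℝ → E3 := fun y => -((p₁ y - μ * k₂ y) • N₁ y + (p₂ y + μ * k₁ y) • N₂ y +
    (Λ y - (1 / 2) * ϱ y * (k₁ y * k₁ y + k₂ y * k₂ y)) • T y) with hC_def
  have hC : SmoothOn a b C := (((ContDiffOn.smul hq₁ h.smooth_normal₁).add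
    (ContDiffOn.smul hq₂ h.smooth_normal₂)).add (ContDiffOn.smul hr h.smooth_tangent)).neg
  have hk₁ := fun x hx => h.smooth_curvature₁.hasDerivWithinAt (x := x) hx
  have hk₂ := fun x hx => h.smooth_curvature₂.hasDerivWithinAt (x := x) hx
  have hDC : ∀ x ∈ Icc a b, D a b C x = 0 := by
    intro x hx
    have e : D a b C x = _ := D_eq hab hx
      ((((((hp₁.D hab).hasDerivWithinAt hx).sub ((hk₂ x hx).const_mul μ)).smul
        (h.smooth_normal₁.hasDerivWithinAt hx)).add
      ((((hp₂.D hab).hasDerivWithinAt hx).add ((hk₁ x hx).const_mul μ)).smul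
        (h.smooth_normal₂.hasDerivWithinAt hx))).add
      (((hΛ.hasDerivWithinAt hx).sub (((hϱ.hasDerivWithinAt hx).const_mul (1 / 2 : ℝ)).mul
        (((hk₁ x hx).mul (hk₁ x hx)).add ((hk₂ x hx).mul (hk₂ x hx))))).smul
        (h.smooth_tangent.hasDerivWithinAt hx))).neg
    have s₁ := hs.first x hx
    have s₂ := hs.second x hx
    have s₃ := hs.multiplier x hx
    -- The normal components of `C'` vanish by the first two equations. The tangential one needs
    -- `(ϱkᵢ)'` expanded, to be matched with the derivative of `½ϱ|κ|²`.
    have d₁ : p₁ x = _ := D_eq hab hx ((hϱ.hasDerivWithinAt hx).mul (hk₁ x hx))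
    have d₂ : p₂ x = _ := D_eq hab hx ((hϱ.hasDerivWithinAt hx).mul (hk₂ x hx))
    rw [← hp₁_def] at s₁
    rw [← hp₂_def] at s₂
    have s₁' : D a b p₁ x = -((1 / 2) * ϱ x * (k₁ x * k₁ x + k₂ x * k₂ x) * k₁ x) +
      μ * D a b k₂ x + Λ x * k₁ x := by linarith
    have s₂' : D a b p₂ x = -((1 / 2) * ϱ x * (k₁ x * k₁ x + k₂ x * k₂ x) * k₂ x) -
      μ * D a b k₁ x + Λ x * k₂ x := by linarith
    have s₃' : D a b Λ x = -((1 / 2) * D a b ϱ x * (k₁ x * k₁ x + k₂ x * k₂ x)) := by linarith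
    rw [e, h.D_normal₁ x hx, h.D_normal₂ x hx, h.D_tangent x hx]
    simp only [Pi.add_apply, Pi.mul_apply, Pi.sub_apply]
    rw [← hp₁_def, ← hp₂_def, s₁', s₂', s₃', d₁, d₂]
    module
  refine ⟨C a, (h.hasFirstIntegral_iff hab hϱ).2 fun x hx => ?_⟩
  rw [← hC.eq_of_D_eq_zero hDC hx]
  have hnn₁ : ⟪N₁ x, N₁ x⟫_ℝ = 1 := by
    rw [real_inner_self_eq_norm_sq, h.norm_normal₁ x hx]; norm_num
  have hnn₂ : ⟪N₂ x, N₂ x⟫_ℝ = 1 := by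
    rw [real_inner_self_eq_norm_sq, h.norm_normal₂ x hx]; norm_num
  have hT₁ : ⟪T x, N₁ x⟫_ℝ = 0 := by rw [real_inner_comm, h.normal₁ x hx]
  have hT₂ : ⟪T x, N₂ x⟫_ℝ = 0 := by rw [real_inner_comm, h.normal₂ x hx]
  have ho : ⟪N₂ x, N₁ x⟫_ℝ = 0 := by rw [real_inner_comm, h.orthogonal x hx]
  change p₁ x = _ ∧ p₂ x = _
  simp only [hC_def, inner_neg_left, inner_add_left, inner_smul_left, hnn₁, hnn₂, hT₁, hT₂, ho,
    h.orthogonal x hx, conj_trivial]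
  constructor <;> ring

theorem D_apply_plane (hab : a < b) {v : ℝ → E2} (hv : SmoothOn a b v) (i : Fin 2) {x : ℝ}
    (hx : x ∈ Icc a b) : D a b v x i = D a b (fun y => v y i) x :=
  (D_eq hab hx ((EuclideanSpace.proj i : E2 →L[ℝ] ℝ).hasFDerivAt.comp_hasDerivWithinAt x (hv.hasDerivWithinAt hx))).symm

/-- The Euler-Lagrange system in vector form is equivalent to the one in components. -/
theorem solvesEulerLagrange_iff (hab : a < b) {κ : ℝ → E2} (hκ : SmoothOn a b κ)
    (hϱ : SmoothOn a b ϱ) {Λ : ℝ → ℝ} {μ : ℝ} :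
    SolvesEulerLagrange a b ϱ (fun y => κ y 0) (fun y => κ y 1) Λ μ ↔
      (∀ x ∈ Icc a b, 0 = D a b (D a b (fun y => ϱ y • κ y)) x
            + ((1 / 2) * ϱ x * ⟪κ x, κ x⟫_ℝ) • κ x
            + μ • rotJ (D a b κ x) - Λ x • κ x) ∧
        (∀ x ∈ Icc a b, 0 = D a b Λ x + (1 / 2) * D a b ϱ x * ⟪κ x, κ x⟫_ℝ) := by
  have hp : SmoothOn a b fun y => ϱ y • κ y := ContDiffOn.smul hϱ hκ
  have e : ∀ i, ∀ x ∈ Icc a b, D a b (D a b (fun y => ϱ y • κ y)) x i =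
      D a b (D a b (fun y => ϱ y * κ y i)) x := fun i x hx => by
    rw [D_apply_plane hab (hp.D hab) i hx]
    refine D_congr (fun y hy => ?_) hx
    rw [D_apply_plane hab hp i hy]
    rfl
  have key : ∀ x ∈ Icc a b, (0 = D a b (D a b (fun y => ϱ y • κ y)) x
            + ((1 / 2) * ϱ x * ⟪κ x, κ x⟫_ℝ) • κ x
            + μ • rotJ (D a b κ x) - Λ x • κ x) ↔
      (0 = D a b (D a b (fun y => ϱ y * κ y 0)) x +
        (1 / 2) * ϱ x * (κ x 0 * κ x 0 + κ x 1 * κ x 1) * κ x 0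
          - μ * D a b (fun y => κ y 1) x - Λ x * κ x 0) ∧
      (0 = D a b (D a b (fun y => ϱ y * κ y 1)) x +
        (1 / 2) * ϱ x * (κ x 0 * κ x 0 + κ x 1 * κ x 1) * κ x 1
          + μ * D a b (fun y => κ y 0) x - Λ x * κ x 1) := by
    intro x hx
    rw [← e 0 x hx, ← e 1 x hx, ← D_apply_plane hab hκ 0 hx, ← D_apply_plane hab hκ 1 hx,
      inner_eq_coord_plane]
    constructor
    · intro h
      have h₀ := congrArg (fun v : E2 => v 0) h
      have h₁ := congrArg (fun v : E2 => v 1) h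
      simp [rotJ] at h₀ h₁
      constructor <;> linarith
    · rintro ⟨h₀, h₁⟩
      ext i
      fin_cases i <;> simp [rotJ] <;> linarith
  simp only [inner_eq_coord_plane] at key ⊢
  constructor
  · intro h
    exact ⟨fun x hx => (key x hx).2 ⟨h.first x hx, h.second x hx⟩, h.multiplier⟩
  · rintro ⟨h₁, h₂⟩
    exact ⟨fun x hx => ((key x hx).1 (h₁ x hx)).1, fun x hx => ((key x hx).1 (h₁ x hx)).2, h₂⟩

end ParallelFrame

/-! ### Criticality and the first integral -/

section Elastic

variable {a b : ℝ} {γ : ℝ → E3} {g : ℝ → ℝ → E3}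

theorem integral_mul_inner_D_eq_neg (hab : a < b) {f ξ : ℝ → E3} {ϱ : ℝ → ℝ} (hf : SmoothOn a b f)
    (hϱ : SmoothOn a b ϱ) (hξ : SmoothOn a b ξ) (ha : ξ a = 0) (hb : ξ b = 0) :
    ∫ x in a..b, ϱ x * ⟪f x, D a b ξ x⟫_ℝ =
      -∫ x in a..b, ⟪D a b (fun y => ϱ y • f y) x, ξ x⟫_ℝ := by
  have hF : SmoothOn a b fun y => ϱ y • f y := ContDiffOn.smul hϱ hf
  have hs : SmoothOn a b fun y => ⟪ϱ y • f y, ξ y⟫_ℝ := ContDiffOn.inner ℝ hF hξ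
  have h := hs.integral_D hab
  rw [ha, hb, inner_zero_right, inner_zero_right, sub_zero] at h
  have h₁ : SmoothOn a b fun x => ϱ x * ⟪f x, D a b ξ x⟫_ℝ :=
    ContDiffOn.mul hϱ (ContDiffOn.inner ℝ hf (hξ.D hab))
  have h₂ : SmoothOn a b fun x => ⟪D a b (fun y => ϱ y • f y) x, ξ x⟫_ℝ :=
    ContDiffOn.inner ℝ (hF.D hab) hξ
  rw [eq_neg_iff_add_eq_zero, ← intervalIntegral.integral_add (h₁.intervalIntegrable hab)
    (h₂.intervalIntegrable hab), ← h]
  refine intervalIntegral.integral_congr fun x hx => ?_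
  rw [uIcc_of_le hab.le] at hx
  rw [D_inner hab hF hξ hx, inner_smul_left]
  rfl

theorem D_left_eq_zero (hab : a < b) {δ : ℝ} (hδ : 0 < δ) {Y : ℝ → E3}
    (h : ∀ x ∈ Icc a b, x ≤ a + δ → Y x = 0) : D a b Y a = 0 := by
  have ha : a ∈ Icc a b := ⟨le_rfl, hab.le⟩
  refine D_eq hab ha ((hasDerivWithinAt_const a _ (0 : E3)).congr_of_eventuallyEq ?_
    (h a ha (by linarith)))
  filter_upwards [self_mem_nhdsWithin, mem_nhdsWithin_of_mem_nhds
    (Iio_mem_nhds (by linarith : a < a + δ))] with y hy hy' using h y hy (le_of_lt hy')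

theorem D_right_eq_zero (hab : a < b) {δ : ℝ} (hδ : 0 < δ) {Y : ℝ → E3}
    (h : ∀ x ∈ Icc a b, b - δ ≤ x → Y x = 0) : D a b Y b = 0 := by
  have hb : b ∈ Icc a b := ⟨hab.le, le_rfl⟩
  refine D_eq hab hb ((hasDerivWithinAt_const b _ (0 : E3)).congr_of_eventuallyEq ?_
    (h b hb (by linarith)))
  filter_upwards [self_mem_nhdsWithin, mem_nhdsWithin_of_mem_nhds
    (Ioi_mem_nhds (by linarith : b - δ < b))] with y hy hy' using h y hy (le_of_lt hy')

theorem paramDeriv_eq_zero {ε : ℝ} (hε : 0 < ε) {x : ℝ} (h : ∀ t ∈ Icc (-ε) ε, g t x = γ x) :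
    paramDeriv g x = 0 := by
  refine HasDerivAt.deriv ((hasDerivAt_const (0 : ℝ) (γ x)).congr_of_eventuallyEq ?_)
  filter_upwards [Icc_mem_nhds (neg_lt_zero.2 hε) hε] with t ht using h t ht

/-- The first variation of the bending energy, integrated by parts. -/
theorem IsVariation.hasDerivAt_bendingEnergy (hab : a < b) (hγ : SmoothOn a b γ)
    (hγ1 : IsArcLengthParam a b γ) {ϱ : ℝ → ℝ} (hϱ : SmoothOn a b ϱ) (hg : IsVariation a b γ g)
    (hc : ConstrainsArcLength a b g) :
    HasDerivAt (fun t => bendingEnergy a b ϱ (g t))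
      (-∫ x in a..b, ⟪D a b (fun y => ϱ y • D a b (unitTangent a b γ) y) x,
        D a b (paramDeriv g) x⟫_ℝ) 0 := by
  obtain ⟨ε, hε, hg, h0, δ, hδ, hfix⟩ := hg
  replace hg : SmoothFamily ε a b g := hg
  rw [← integral_mul_inner_D_eq_neg hab ((hγ1.smoothOn_unitTangent hab hγ).D hab) hϱ
    ((hg.smoothOn_paramDeriv hε hab).D hab)]
  · exact ElasticCurve.hasDerivAt_bendingEnergy hab hγ1 hϱ hε hg h0 hc
  · exact D_left_eq_zero hab hδ fun x hx hxa =>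
      paramDeriv_eq_zero hε fun t ht => hfix t ht x hx (Or.inl hxa)
  · exact D_right_eq_zero hab hδ fun x hx hxb =>
      paramDeriv_eq_zero hε fun t ht => hfix t ht x hx (Or.inr hxb)

theorem IsVariation.integral_D_paramDeriv (hab : a < b) (hg : IsVariation a b γ g) :
    ∫ x in a..b, D a b (paramDeriv g) x = 0 := by
  obtain ⟨ε, hε, hg, h0, δ, hδ, hfix⟩ := hg
  replace hg : SmoothFamily ε a b g := hg
  rw [(hg.smoothOn_paramDeriv hε hab).integral_D hab,
    paramDeriv_eq_zero hε fun t ht => hfix t ht b ⟨hab.le, le_rfl⟩ (Or.inr (by linarith)),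
    paramDeriv_eq_zero hε fun t ht => hfix t ht a ⟨le_rfl, hab.le⟩ (Or.inl (by linarith)), sub_zero]

/-- Integrated against `ξ = Y'`, the first integral writes the energy variation as a combination of
`⟨c, ∫ ξ⟩`, zero by compact support, and the holonomy variation, zero by assumption. -/
theorem isHolonomyConstrainedElastic_of_hasFirstIntegral (hab : a < b) (hγ : SmoothOn a b γ)
    (hγ1 : IsArcLengthParam a b γ) {ϱ : ℝ → ℝ} (hϱ : SmoothOn a b ϱ) {Wa Wb : E3}
    (hW : IsNormalPair a b γ Wa Wb) {N : ℝ → E3} (hN : IsParallelNormalField a b γ N)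
    (hN1 : ∀ x ∈ Icc a b, ‖N x‖ = 1) {c : E3} {μ : ℝ}
    (h : HasFirstIntegral a b (unitTangent a b γ) ϱ c μ) :
    IsHolonomyConstrainedElastic a b ϱ γ Wa Wb := by
  intro g hg hc hh
  have hb : b ∈ Icc a b := ⟨hab.le, le_rfl⟩
  have hT := hγ1.smoothOn_unitTangent hab hγ
  convert! hg.hasDerivAt_bendingEnergy hab hγ hγ1 hϱ hc using 1
  obtain ⟨θ, hθ, hθ'⟩ := hh
  obtain ⟨η, hη, hη'⟩ := exists_hasDerivAt_isHolonomy hab hγ hγ1 hN hN1 hW hg hc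
  have hY := hg.integral_D_paramDeriv hab
  obtain ⟨ε, hε, hg, h0, δ, hδ, hfix⟩ := hg
  replace hg : SmoothFamily ε a b g := hg
  have hξ := (hg.smoothOn_paramDeriv hε hab).D hab
  have hTb : ∀ᶠ t in 𝓝 (0 : ℝ), unitTangent a b (g t) b = unitTangent a b γ b := by
    filter_upwards [Icc_mem_nhds (neg_lt_zero.2 hε) hε] with t ht
    refine unitTangent_congr hb ?_
    filter_upwards [self_mem_nhdsWithin, mem_nhdsWithin_of_mem_nhds
      (Ioi_mem_nhds (by linarith : b - δ < b))] with y hy hy'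
    exact hfix t ht y hy (Or.inr (le_of_lt hy'))
  -- The lift supplied by the constraint need not be the one computed explicitly, but the two
  -- derivatives agree, so the holonomy integral is zero.
  have hzero := IsHolonomy.eq_of_hasDerivAt hab hW.norm_right
    (hTb.mono fun t ht => ⟨by rw [ht]; exact hW.normal_right,
      by rw [ht]; exact hγ1.norm_unitTangent hb⟩) hθ hη hθ' hη'
  have hs₁ : SmoothOn a b fun x => ⟪c, D a b (paramDeriv g) x⟫_ℝ :=
    contDiffOn_const.inner ℝ hξ
  have hs₂ : SmoothOn a b fun x => μ * ⟪D a b (unitTangent a b γ) x,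
      cross (unitTangent a b γ x) (D a b (paramDeriv g) x)⟫_ℝ :=
    contDiffOn_const.mul (ContDiffOn.inner ℝ (hT.D hab) (ContDiffOn.cross hT hξ))
  have hcint : ∫ x in a..b, ⟪c, D a b (paramDeriv g) x⟫_ℝ = 0 := by
    have := (innerSL ℝ c).intervalIntegral_comp_comm (hξ.intervalIntegrable hab)
    simp only [innerSL_apply_apply] at this
    rw [this, hY, inner_zero_right]
  have e : ∫ x in a..b, ⟪D a b (fun y => ϱ y • D a b (unitTangent a b γ) y) x,
      D a b (paramDeriv g) x⟫_ℝ = ∫ x in a..b, (⟪c, D a b (paramDeriv g) x⟫_ℝ +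
        μ * ⟪D a b (unitTangent a b γ) x,
          cross (unitTangent a b γ x) (D a b (paramDeriv g) x)⟫_ℝ) := by
    refine intervalIntegral.integral_congr fun x hx => ?_
    rw [uIcc_of_le hab.le] at hx
    exact h x hx _ (hc.inner_eq_zero hab hγ1 hε hg h0 hx)
  rw [e, intervalIntegral.integral_add (hs₁.intervalIntegrable hab) (hs₂.intervalIntegrable hab),
    intervalIntegral.integral_const_mul, ← hzero, hcint]
  simp

/-- For an elastic curve, the first variation of the bending energy vanishes on all fields `ξ = Y'`
that satisfy the linearized constraints. -/
theorem IsHolonomyConstrainedElastic.integral_eq_zero (hab : a < b) (hγ : SmoothOn a b γ)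
    (hγ1 : IsArcLengthParam a b γ) {ϱ : ℝ → ℝ} (hϱ : SmoothOn a b ϱ) {Wa Wb : E3}
    (hW : IsNormalPair a b γ Wa Wb) {N : ℝ → E3} (hN : IsParallelNormalField a b γ N)
    (hN1 : ∀ x ∈ Icc a b, ‖N x‖ = 1) (hel : IsHolonomyConstrainedElastic a b ϱ γ Wa Wb)
    {ξ : ℝ → E3} (hξ : SmoothOn a b ξ) (hξT : ∀ x ∈ Icc a b, ⟪unitTangent a b γ x, ξ x⟫_ℝ = 0)
    {δ : ℝ} (hδ : 0 < δ) (hsupp : ∀ x, (x ≤ a + δ ∨ b - δ ≤ x) → ξ x = 0)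
    (hint : ∫ x in a..b, ξ x = 0)
    (hhol : ∫ x in a..b, ⟪D a b (unitTangent a b γ) x, cross (unitTangent a b γ x) (ξ x)⟫_ℝ = 0) :
    ∫ x in a..b, ⟪D a b (fun y => ϱ y • D a b (unitTangent a b γ) y) x, ξ x⟫_ℝ = 0 := by
  -- The primitive vanishes near `a` by the support condition, and near `b` because moreover `∫ ξ =
  -- 0`.
  set Y : ℝ → E3 := fun x => ∫ s in a..x, ξ s
  have hY : SmoothOn a b Y := hξ.integral hab
  have hDY : ∀ x ∈ Icc a b, D a b Y x = ξ x := fun x hx =>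
    D_eq hab hx (hξ.hasDerivWithinAt_integral hx)
  have hYsupp : ∀ x ∈ Icc a b, (x ≤ a + δ ∨ b - δ ≤ x) → Y x = 0 := by
    rintro x hx (h | h)
    · refine (intervalIntegral.integral_congr fun y hy => ?_).trans
        (intervalIntegral.integral_zero (a := a) (b := x))
      rw [uIcc_of_le hx.1] at hy
      exact hsupp y (Or.inl (hy.2.trans h))
    · have h₁ : ∫ s in x..b, ξ s = 0 := by
        refine (intervalIntegral.integral_congr fun y hy => ?_).trans
          (intervalIntegral.integral_zero (a := x) (b := b))
        rw [uIcc_of_le hx.2] at hy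
        exact hsupp y (Or.inr (h.trans hy.1))
      have hi := hξ.intervalIntegrable hab
      have hxs : x ∈ Set.uIcc a b := by rwa [uIcc_of_le hab.le]
      have h₂ := intervalIntegral.integral_add_adjacent_intervals
        (hi.mono_set (uIcc_subset_uIcc_left hxs)) (hi.mono_set (uIcc_subset_uIcc_right hxs))
      rw [h₁, hint, add_zero] at h₂
      exact h₂
  -- An affine variation suffices: the constraints concern only the first order in `t`, so no
  -- correction to satisfy them exactly is required.
  set g : ℝ → ℝ → E3 := fun t x => γ x + t • Y x
  have hgs : SmoothFamily 1 a b g :=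
    (hγ.family 1).add (contDiff_fst.contDiffOn.smul (hY.family 1))
  have hvar : IsVariation a b γ g :=
    ⟨1, one_pos, hgs, fun x _ => by simp [g], δ, hδ, fun t _ x hx h => by
      simp [g, hYsupp x hx h]⟩
  have hpd : ∀ x, paramDeriv g x = Y x := fun x => by
    have := (((hasDerivAt_id (0 : ℝ)).smul_const (Y x)).const_add (γ x)).deriv
    rw [one_smul] at this
    exact this
  have hDpd : ∀ x ∈ Icc a b, D a b (paramDeriv g) x = ξ x := fun x hx => by
    rw [← hDY x hx]; exact D_congr (fun y _ => hpd y) hx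
  have hg0 : ∀ x ∈ Icc a b, g 0 x = γ x := fun x _ => by simp [g]
  have harc : ConstrainsArcLength a b g := fun x hx => by
    have h := hasDerivAt_norm_of_norm_eq_one (hgs.hasDerivAt_D one_pos hab hx)
      (by rw [D_congr hg0 hx, hγ1 x hx])
    rwa [hDpd x hx, D_congr hg0 hx, ← hγ1.unitTangent_eq hx, hξT x hx] at h
  have hcongr : ∀ f : ℝ → E3 → ℝ, ∫ x in a..b, f x (D a b (paramDeriv g) x) =
      ∫ x in a..b, f x (ξ x) := fun f =>
    intervalIntegral.integral_congr fun x hx => by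
      rw [uIcc_of_le hab.le] at hx
      simp only [hDpd x hx]
  obtain ⟨θ, hθ, hθ'⟩ := exists_hasDerivAt_isHolonomy hab hγ hγ1 hN hN1 hW hvar harc
  rw [hcongr fun x v => ⟪D a b (unitTangent a b γ) x, cross (unitTangent a b γ x) v⟫_ℝ,
    hhol] at hθ'
  have h := (hvar.hasDerivAt_bendingEnergy hab hγ hγ1 hϱ harc).unique
    (hel g hvar harc ⟨θ, hθ, hθ'⟩)
  rw [hcongr fun x v => ⟪D a b (fun y => ϱ y • D a b (unitTangent a b γ) y) x, v⟫_ℝ] at h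
  exact neg_eq_zero.1 h

/-- A compact set inside the open interval keeps a positive distance from both ends; this margin is
what `IsVariation` asks for. -/
theorem exists_eq_zero_near_endpoints {u : ℝ → ℝ} (hu : u ∈ testSpace a b) :
    ∃ δ > 0, ∀ x, (x ≤ a + δ ∨ b - δ ≤ x) → u x = 0 := by
  obtain ⟨-, hc, hs⟩ := hu
  have hK : IsCompact (tsupport u) := hc
  have h : ∀ᶠ δ in 𝓝 (0 : ℝ), ∀ x ∈ tsupport u, a + δ < x ∧ x < b - δ := by
    refine hK.eventually_forall_of_forall_eventually (P := fun δ x => a + δ < x ∧ x < b - δ)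
      fun x hx => ?_
    have h₁ : Continuous fun z : ℝ × ℝ => z.2 - a - z.1 := by fun_prop
    have h₂ : Continuous fun z : ℝ × ℝ => b - z.1 - z.2 := by fun_prop
    filter_upwards [h₁.continuousAt.eventually (lt_mem_nhds (a := (0 : ℝ)) (by
        have := (hs hx).1; simp only; linarith)),
      h₂.continuousAt.eventually (lt_mem_nhds (a := (0 : ℝ)) (by
        have := (hs hx).2; simp only; linarith))] with z hz₁ hz₂
    constructor <;> linarith
  obtain ⟨r, hr, hr'⟩ := Metric.eventually_nhds_iff.1 h
  refine ⟨r / 2, by positivity, fun x hx => ?_⟩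
  by_contra hne
  have := @hr' (r / 2) (by
    rw [Real.dist_eq, sub_zero, abs_of_pos (by positivity)]; linarith) x
    (subset_tsupport u hne)
  rcases hx with hx | hx <;> linarith

/-- Fields `ξ = uN₁ + vN₂` with test functions `u, v` are automatically normal, so the arc-length
constraint disappears and only four scalar integral constraints are left for the multiplier rule. -/
theorem IsHolonomyConstrainedElastic.exists_hasFirstIntegral (hab : a < b) (hγ : SmoothOn a b γ)
    (hγ1 : IsArcLengthParam a b γ) {ϱ : ℝ → ℝ} (hϱ : SmoothOn a b ϱ) {Wa Wb : E3}
    (hW : IsNormalPair a b γ Wa Wb) {N₁ N₂ : ℝ → E3} (hN : IsParallelNormalField a b γ N₁)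
    {k₁ k₂ : ℝ → ℝ} (hf : IsAdaptedFrame a b (unitTangent a b γ) N₁ N₂ k₁ k₂)
    (hel : IsHolonomyConstrainedElastic a b ϱ γ Wa Wb) :
    ∃ (c : E3) (μ : ℝ), HasFirstIntegral a b (unitTangent a b γ) ϱ c μ := by
  set T := unitTangent a b γ
  have hT : SmoothOn a b T := hf.smooth_tangent
  set G : ℝ → E3 := D a b (fun y => ϱ y • D a b T y)
  have hG : SmoothOn a b G := SmoothOn.D hab (ContDiffOn.smul hϱ (hT.D hab))
  have hcoord : ∀ {v : ℝ → E3}, SmoothOn a b v → ∀ i, SmoothOn a b fun x => v x i :=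
    fun hv i => contDiffOn_euclidean.1 hv i
  have hh : ∀ {v : ℝ → E3}, SmoothOn a b v →
      SmoothOn a b fun x => ⟪D a b T x, cross (T x) (v x)⟫_ℝ :=
    fun hv => ContDiffOn.inner ℝ (hT.D hab) (ContDiffOn.cross hT hv)
  have hG' : ∀ {v : ℝ → E3}, SmoothOn a b v → SmoothOn a b fun x => ⟪G x, v x⟫_ℝ :=
    fun hv => ContDiffOn.inner ℝ hG hv
  -- Densities of the four constraints: `none` is the holonomy and yields `μ`; `some i` is the
  -- `i`-th coordinate of `∫ ξ` and yields the `i`-th coordinate of `c`.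
  let w : (ℝ → E3) → Option (Fin 3) → ℝ → ℝ := fun v o x =>
    o.elim ⟪D a b T x, cross (T x) (v x)⟫_ℝ fun i => v x i
  have hw : ∀ {v : ℝ → E3}, SmoothOn a b v → ∀ o, ContinuousOn (w v o) (Icc a b) := by
    rintro v hv (_ | i)
    · exact (hh hv).continuousOn
    · exact (hcoord hv i).continuousOn
  obtain ⟨c, hc⟩ := exists_multipliers hab (hG' hf.smooth_normal₁).continuousOn
    (hG' hf.smooth_normal₂).continuousOn (hw hf.smooth_normal₁) (hw hf.smooth_normal₂) (by
    intro u hu v hv hcon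
    set ξ : ℝ → E3 := fun x => u x • N₁ x + v x • N₂ x with hξ_def
    have hξ : SmoothOn a b ξ := (hu.1.contDiffOn.smul hf.smooth_normal₁).add
      (hv.1.contDiffOn.smul hf.smooth_normal₂)
    have hlin : ∀ f₁ f₂ : ℝ → ℝ, ContinuousOn f₁ (Icc a b) → ContinuousOn f₂ (Icc a b) →
        ∫ x in a..b, (u x * f₁ x + v x * f₂ x) =
          (∫ x in a..b, u x * f₁ x) + ∫ x in a..b, v x * f₂ x := fun f₁ f₂ h₁ h₂ =>
      intervalIntegral.integral_add (intervalIntegrable_testSpace_mul hab h₁ hu)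
        (intervalIntegrable_testSpace_mul hab h₂ hv)
    obtain ⟨δ₁, hδ₁, hz₁⟩ := exists_eq_zero_near_endpoints hu
    obtain ⟨δ₂, hδ₂, hz₂⟩ := exists_eq_zero_near_endpoints hv
    have hmain := hel.integral_eq_zero hab hγ hγ1 hϱ hW hN hf.norm_normal₁ hξ
      (fun x hx => by
        have n₁ := hf.normal₁ x hx
        have n₂ := hf.normal₂ x hx
        rw [real_inner_comm] at n₁ n₂
        simp only [hξ_def, inner_add_right, inner_smul_right]
        change u x * ⟪T x, N₁ x⟫_ℝ + v x * ⟪T x, N₂ x⟫_ℝ = 0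
        rw [n₁, n₂]
        ring)
      (δ := min δ₁ δ₂) (lt_min hδ₁ hδ₂)
      (fun x hx => by
        have m₁ := min_le_left δ₁ δ₂
        have m₂ := min_le_right δ₁ δ₂
        rw [hξ_def]
        simp only
        rw [hz₁ x (hx.imp (fun h => by linarith) fun h => by linarith),
          hz₂ x (hx.imp (fun h => by linarith) fun h => by linarith)]
        simp)
      (by
        ext i
        have h₁ := (EuclideanSpace.proj i : E3 →L[ℝ] ℝ).intervalIntegral_comp_comm
          (hξ.intervalIntegrable hab)
        have h₂ := hcon (some i)
        rw [← hlin _ _ (hw hf.smooth_normal₁ _) (hw hf.smooth_normal₂ _)] at h₂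
        exact h₁.symm.trans h₂)
      (by
        have h₂ := hcon none
        rw [← hlin _ _ (hw hf.smooth_normal₁ _) (hw hf.smooth_normal₂ _)] at h₂
        rw [← h₂]
        refine intervalIntegral.integral_congr fun x _ => ?_
        simp only [hξ_def, cross_add_right, cross_smul_right, inner_add_right, inner_smul_right]
        rfl)
    rw [← hlin _ _ (hG' hf.smooth_normal₁).continuousOn (hG' hf.smooth_normal₂).continuousOn,
      ← hmain]
    refine intervalIntegral.integral_congr fun x _ => ?_
    simp only [hξ_def, inner_add_right, inner_smul_right]
    rfl)
  refine ⟨WithLp.toLp 2 fun i => c (some i), c none, fun x hx ξ hξ => ?_⟩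
  obtain ⟨h₁, h₂⟩ := hc x hx
  rw [Fintype.sum_option, Fin.sum_univ_three] at h₁ h₂
  have e : ∀ v : E3, ⟪(WithLp.toLp 2 fun i => c (some i) : E3), v⟫_ℝ =
      c (some 0) * v 0 + c (some 1) * v 1 + c (some 2) * v 2 := fun v => by
    rw [inner_eq_coord]
  change ⟪G x, ξ⟫_ℝ = _
  rw [hf.eq_sum hx hξ]
  simp only [inner_add_right, inner_smul_right, cross_add_right, cross_smul_right, h₁, h₂, e]
  simp only [w, Option.elim, PiLp.add_apply, PiLp.smul_apply, smul_eq_mul]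
  ring

end Elastic

end ElasticCurve

end

/-! ### The characterization of holonomy constrained elastic curves -/

theorem theorem4p5 (a b : ℝ) (hab : a < b)
    (γ : ℝ → ElasticCurve.E3) (hγ : ElasticCurve.SmoothOn a b γ)
    (hγ1 : ElasticCurve.IsArcLengthParam a b γ)
    (ϱ : ℝ → ℝ) (hϱ : ElasticCurve.SmoothOn a b ϱ) (hϱ0 : ∀ x ∈ Set.Icc a b, 0 < ϱ x)
    (Wa Wb : ElasticCurve.E3) (hW : ElasticCurve.IsNormalPair a b γ Wa Wb)
    (κ : ℝ → ElasticCurve.E2) (hκ : ElasticCurve.IsCurvatureFunction a b γ κ) :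
    ElasticCurve.IsHolonomyConstrainedElastic a b ϱ γ Wa Wb ↔
      ∃ (Λ : ℝ → ℝ) (μ : ℝ), ElasticCurve.SmoothOn a b Λ ∧
        (∀ x ∈ Set.Icc a b,
          0 = ElasticCurve.D a b (ElasticCurve.D a b (fun y => ϱ y • κ y)) x
            + ((1 / 2) * ϱ x * ⟪κ x, κ x⟫_ℝ) • κ x
            + μ • ElasticCurve.rotJ (ElasticCurve.D a b κ x) - Λ x • κ x) ∧
        (∀ x ∈ Set.Icc a b,
          0 = ElasticCurve.D a b Λ x
            + (1 / 2) * ElasticCurve.D a b ϱ x * ⟪κ x, κ x⟫_ℝ) := by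
  obtain ⟨N₁, N₂, hN, hk⟩ := hκ
  have hf := hN.isAdaptedFrame hab hγ hγ1 hk
  -- The smoothness of `κ` comes from the frame, not from a hypothesis.
  have hκs : ElasticCurve.SmoothOn a b κ := contDiffOn_euclidean.2 fun i => by
    fin_cases i
    · exact hf.smooth_curvature₁
    · exact hf.smooth_curvature₂
  constructor
  · intro hel
    obtain ⟨c, μ, hi⟩ := hel.exists_hasFirstIntegral hab hγ hγ1 hϱ hW hN.parallel₁ hf
    obtain ⟨Λ, hΛ, hs⟩ := hf.exists_solvesEulerLagrange hab hϱ hi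
    exact ⟨Λ, μ, hΛ, (ElasticCurve.solvesEulerLagrange_iff hab hκs hϱ).1 hs⟩
  · rintro ⟨Λ, μ, hΛ, hs⟩
    obtain ⟨c, hi⟩ := hf.exists_hasFirstIntegral hab hϱ hΛ
      ((ElasticCurve.solvesEulerLagrange_iff hab hκs hϱ).2 hs)
    exact ElasticCurve.isHolonomyConstrainedElastic_of_hasFirstIntegral hab hγ hγ1 hϱ hW
      hN.parallel₁ hN.unit₁ hi
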